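/- Let $n\ge 1$. For a constant $c\in\{0,1\}^n$, identified with an integer $0\le c<2^n$ by its binary expansion, the $n$-bit classical--quantum comparator is the unitary on $n+1$ qubits $$|a\rangle|z\rangle\mapsto|a\rangle|z\oplus(c<a)\rangle,\qquad a\in\{0,1\}^n,\ z\in\{0,1\},$$ where $a$ is likewise read as an integer and $(c<a)$ is $1$ if $c<a$ and $0$ otherwise. Its $k$-controlled version acts on $k$ further qubits, and applies the comparator exactly when these $k$ control qubits are all in the state $|1\rangle$. A circuit over $\{CCX,CX,X\}$ is a sequence of layers, each consisting of one or more Toffoli ($CCX$), CNOT ($CX$) and NOT ($X$) gates on pairwise disjoint sets of qubits; its gate count is its total number of gates and its depth is its number of layers. A circuit on one more qubit implements a unitary $U$ using one dirty ancilla if its unitary is $U\otimes I$, that is, the additional qubit may be in an arbitrary state and is restored to it. There are constants $\alpha,\beta>0$ such that the following holds for all integers $k,n\ge 1$ with $kn\ge 2$. 1. For every $c\in\{0,1\}^n$, the $k$-controlled $n$-bit classical--quantum comparator with constant $c$ is implemented, using one dirty ancilla, by a circuit over $\{CCX,CX,X\}$ whose gate count lies between $\alpha(k+n)$ and $\beta(k+n)$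 and whose depth lies between $\alpha\log(kn)$ and $\beta\log(kn)$. That is, it can be implemented with $\Theta(k+n)$ gates and $\Theta(\log(kn))$ depth, uniformly in $c$. 2. These bounds are optimal up to constant factors in the worst case over $c$: for some $c\in\{0,1\}^n$, every circuit over $\{CCX,CX,X\}$ that implements the $k$-controlled comparator with constant $c$ using one dirty ancilla has gate count at least $\alpha(k+n)$ and depth at least $\alpha\log(kn)$. -/

import Mathlib

open scoped Kronecker

namespace QCircuit

/-- Operators on the state space of qubits labelled by `W`, as matrices in the computational
basis `|x⟩`, `x : W → Bool`. -/
abbrev Op (W : Type) : Type := Matrix (W → Bool) (W → Bool) ℂ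

/-- The operator `|x⟩ ↦ |f x⟩`, extended linearly. -/
def basisOp {W : Type} [Fintype W] (f : (W → Bool) → (W → Bool)) : Op W :=
  Matrix.of fun y x => if y = f x then 1 else 0

/-- The operator `U ⊗ V`, with `U` acting on the qubits `A` and `V` on the qubits `B`. -/
def tensor {A B : Type} (U : Op A) (V : Op B) : Op (A ⊕ B) :=
  (U ⊗ₖ V).submatrix (Equiv.sumArrowEquivProdArrow A B Bool) (Equiv.sumArrowEquivProdArrow A B Bool)

/-- The `k`-controlled operator `|1…1⟩⟨1…1| ⊗ U + (1 - |1…1⟩⟨1…1|) ⊗ 1`: it applies `U`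
exactly when all `k` control qubits are in the state `|1⟩`. -/
def controlled (k : ℕ) {W : Type} [Fintype W] [DecidableEq W] (U : Op W) : Op (Fin k ⊕ W) :=
  let P : Op (Fin k) := Matrix.single (fun _ => true) (fun _ => true) 1
  tensor P U + tensor (1 - P) 1

/-- A gate of `{CCX, CX, X}` placed on the qubits `W`: a `C^j X` gate with `j ≤ 2` controls. -/
structure Gate (W : Type) where
  controls : Finset W
  target : W
  target_notMem : target ∉ controls
  card_le : controls.card ≤ 2

namespace Gate

variable {W : Type} [Fintype W] [DecidableEq W]

/-- The qubits that the gate acts on. -/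
def support (g : Gate W) : Finset W := insert g.target g.controls

/-- The gate flips the target bit if all control bits are `1`. -/
def act (g : Gate W) (x : W → Bool) : W → Bool :=
  Function.update x g.target (xor (x g.target) (decide (∀ i ∈ g.controls, x i = true)))

/-- The unitary of the gate on all the qubits `W`. -/
def op (g : Gate W) : Op W := basisOp g.act

end Gate

/-- A layer of a circuit: one or more gates acting in parallel on pairwise disjoint qubits. -/
structure Layer (W : Type) [DecidableEq W] where
  gates : List (Gate W)
  ne_nil : gates ≠ []
  disjoint : gates.Pairwise fun g h => Disjoint g.support h.support

/-- A circuit over `{CCX, CX, X}`: its layers in the order of time. -/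
structure Circuit (W : Type) [DecidableEq W] where
  layers : List (Layer W)

/-- The operator of a sequence of gates, where the first gate of the list is applied first. -/
def opOfGates {W : Type} [Fintype W] [DecidableEq W] : List (Gate W) → Op W
  | [] => 1
  | g :: gs => opOfGates gs * g.op

namespace Circuit

variable {W : Type} [Fintype W] [DecidableEq W]

/-- All gates of the circuit. -/
def gates (C : Circuit W) : List (Gate W) := C.layers.flatMap Layer.gates

/-- The gate count. -/
def size (C : Circuit W) : ℕ := C.gates.length

/-- The circuit depth. -/
def depth (C : Circuit W) : ℕ := C.layers.length

/-- The operator that the circuit implements. -/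
def op (C : Circuit W) : Op W := opOfGates C.gates

/-- The circuit implements `U` with one dirty ancilla: for every state of the ancilla (even one
entangled with other qubits) `U` is applied to the other qubits and the ancilla is restored. -/
def ImplementsWithDirtyAncilla (C : Circuit (W ⊕ Fin 1)) (U : Op W) : Prop :=
  C.op = tensor U 1

end Circuit

/-- The natural number with the binary digits `x`, where `x 0` is the least significant one. -/
def value {n : ℕ} (x : Fin n → Bool) : ℕ := ∑ i : Fin n, if x i then 2 ^ (i : ℕ) else 0

/-- The `n`-bit classical--quantum comparator `|a⟩|z⟩ ↦ |a⟩|z ⊕ (c < a)⟩`. -/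
def comparator {n : ℕ} (c : Fin n → Bool) : Op (Fin n ⊕ Fin 1) :=
  basisOp fun x =>
    let a : Fin n → Bool := fun i => x (Sum.inl i)
    let z : Bool := x (Sum.inr 0)
    Sum.elim a fun _ => xor z (decide (value c < value a))

end QCircuit

/-! A circuit over this gate set permutes the basis states, so implementing the comparator means
flipping the target by a Boolean function and restoring all other bits. Let y be the input a with
the bits flipped where c is 0; then y marks the places where a and c agree, and c < a is decided at
the first disagreement from the top. Put the controls in front and take differences of consecutive
answers. The function becomes a nested expression x₁ ∧ (e₁ ⊕ x₂ ∧ (e₂ ⊕ ⋯)) of length N = k + n,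
called `val`.

The difficulty is to evaluate `val` in O(N) gates and O(log N) depth with a single dirty qubit. The
data bits themselves serve as workspace. Cut off a prefix A of about 2 log N bits. The part of `val`
beyond A matters only if all bits of A are 1, and in that case A is a workspace in a known state;
otherwise the computed value is masked. The prefix is handled by a Toffoli ladder that borrows
further data bits as dirty qubits. Beyond A, blocks of doubling size are evaluated by balanced
trees, each using the preceding block, again supposed to be all 1, as workspace. About log N blocks
arise; those of even and of odd index run in two parallel rounds, and their results, two bits per
block, are collected by a Horner scheme (`exists_tree`, `exists_stages`, `exists_compute`,
`exists_toggle_val`).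

Conversely, for c = 0 the target depends on all k + n controls and input bits. Each gate touches at
most three qubits, and each layer at most triples the set of bits on which a given bit depends; this
bounds size and depth from below. Since the lower bounds in the first claim are required for every
c, the constructed circuit is padded with layers that cancel. -/

namespace QCircuit

/-! ### Gate lists as permutations of bit strings, parallel scheduling, nested expressions -/

section Basics

set_option linter.unusedSectionVars false

variable {W : Type} [Fintype W] [DecidableEq W]

/-- The gate `X` on the qubit `t`. -/
def Gate.notGate (t : W) : Gate W := ⟨∅, t, by simp, by simp⟩

/-- The gate `CX` with control `a` and target `t`. -/
def Gate.cnot (a t : W) (h : t ≠ a) : Gate W := ⟨{a}, t, by simpa using h, by simp⟩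

/-- The gate `CCX` with controls `a`, `b` and target `t`. -/
def Gate.toffoli (a b t : W) (ha : t ≠ a) (hb : t ≠ b) : Gate W :=
  ⟨{a, b}, t, by simp [ha, hb], Finset.card_le_two⟩

@[simp] theorem Gate.notGate_support (t : W) : (Gate.notGate t).support = {t} := rfl

@[simp] theorem Gate.cnot_support (a t : W) (h : t ≠ a) : (Gate.cnot a t h).support = {t, a} := rfl

@[simp] theorem Gate.toffoli_support (a b t : W) (ha : t ≠ a) (hb : t ≠ b) :
    (Gate.toffoli a b t ha hb).support = {t, a, b} := rfl

theorem Gate.notGate_act (t : W) (x : W → Bool) :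
    (Gate.notGate t).act x = Function.update x t (!x t) := by
  simp [Gate.act, Gate.notGate]

theorem Gate.cnot_act (a t : W) (h : t ≠ a) (x : W → Bool) :
    (Gate.cnot a t h).act x = Function.update x t (xor (x t) (x a)) := by
  simp [Gate.act, Gate.cnot]

theorem Gate.toffoli_act (a b t : W) (ha : t ≠ a) (hb : t ≠ b) (x : W → Bool) :
    (Gate.toffoli a b t ha hb).act x = Function.update x t (xor (x t) (x a && x b)) := by
  simp [Gate.act, Gate.toffoli, Bool.decide_and]

theorem Gate.act_of_ne (g : Gate W) (x : W → Bool) {w : W} (h : w ∉ g.support) :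
    g.act x w = x w := by
  have : w ≠ g.target := fun e => h (by simp [Gate.support, e])
  simp [Gate.act, this]

theorem Gate.act_congr (g : Gate W) {x y : W → Bool} {w : W} (hw : x w = y w)
    (h : ∀ v ∈ g.support, x v = y v) : g.act x w = g.act y w := by
  have ht : x g.target = y g.target := h _ (by simp [Gate.support])
  have hc : (∀ i ∈ g.controls, x i = true) ↔ (∀ i ∈ g.controls, y i = true) :=
    forall₂_congr fun i hi => by rw [h i (by simp [Gate.support, hi])]
  unfold Gate.act
  by_cases e : w = g.target
  · subst e; simp [ht, hc]
  · simp [e, hw]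

theorem Gate.act_act (g : Gate W) (x : W → Bool) : g.act (g.act x) = x := by
  have hc : (∀ i ∈ g.controls, g.act x i = true) ↔ (∀ i ∈ g.controls, x i = true) :=
    forall₂_congr fun i hi => by
      have : i ≠ g.target := fun e => g.target_notMem (e ▸ hi)
      simp [Gate.act, this]
  funext w
  by_cases e : w = g.target
  · subst e
    rw [Gate.act, Function.update_self]
    simp only [hc]
    simp [Gate.act]
  · simp [e, Gate.act]

theorem Gate.act_comm (g h : Gate W) (hd : Disjoint g.support h.support) (x : W → Bool) :
    g.act (h.act x) = h.act (g.act x) := by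
  have key : ∀ (g h : Gate W), Disjoint g.support h.support → ∀ w ∈ g.support,
      g.act (h.act x) w = h.act (g.act x) w := fun g h hd w hw => by
    have hw' : ∀ v ∈ g.support, v ∉ h.support := fun v hv hv' =>
      (Finset.disjoint_left.1 hd hv) hv'
    rw [h.act_of_ne _ (hw' w hw)]
    exact g.act_congr (h.act_of_ne _ (hw' w hw)) fun v hv => h.act_of_ne _ (hw' v hv)
  funext w
  by_cases hw : w ∈ g.support
  · exact key g h hd w hw
  by_cases hw' : w ∈ h.support
  · exact (key h g hd.symm w hw').symm
  rw [g.act_of_ne _ hw, h.act_of_ne _ hw', h.act_of_ne _ hw', g.act_of_ne _ hw]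

/-- The action of a sequence of gates on the basis states. -/
def run (C : List (Gate W)) (x : W → Bool) : W → Bool := C.foldl (fun x g => g.act x) x

@[simp] theorem run_nil (x : W → Bool) : run [] x = x := rfl

@[simp] theorem run_cons (g : Gate W) (C : List (Gate W)) (x : W → Bool) :
    run (g :: C) x = run C (g.act x) := rfl

@[simp] theorem run_append (C D : List (Gate W)) (x : W → Bool) :
    run (C ++ D) x = run D (run C x) := List.foldl_append

theorem run_reverse_run (C : List (Gate W)) (x : W → Bool) : run C.reverse (run C x) = x := by
  induction C generalizing x with
  | nil => rfl
  | cons g C ih => simp [ih, Gate.act_act]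

theorem run_run_reverse (C : List (Gate W)) (x : W → Bool) : run C (run C.reverse x) = x := by
  simpa using run_reverse_run C.reverse x

/-- All gates act on qubits of the list `L`. -/
def Within (C : List (Gate W)) (L : List W) : Prop := ∀ g ∈ C, ∀ w ∈ g.support, w ∈ L

theorem Within.mono {C : List (Gate W)} {L L' : List W} (h : Within C L) (hL : ∀ w ∈ L, w ∈ L') :
    Within C L' := fun g hg w hw => hL w (h g hg w hw)

theorem Within.nil (L : List W) : Within ([] : List (Gate W)) L := by simp [Within]

theorem Within.append {C D : List (Gate W)} {L : List W} (h : Within C L) (h' : Within D L) :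
    Within (C ++ D) L := fun g hg => (List.mem_append.1 hg).elim (h g) (h' g)

theorem Within.cons {g : Gate W} {D : List (Gate W)} {L : List W} (h : ∀ w ∈ g.support, w ∈ L)
    (h' : Within D L) : Within (g :: D) L := fun g' hg =>
  (List.mem_cons.1 hg).elim (fun e => e ▸ h) (h' g')

theorem Within.reverse {C : List (Gate W)} {L : List W} (h : Within C L) :
    Within C.reverse L := fun g hg => h g (List.mem_reverse.1 hg)

theorem Within.run_of_notMem {C : List (Gate W)} {L : List W} (h : Within C L) (x : W → Bool)
    {w : W} (hw : w ∉ L) : run C x w = x w := by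
  induction C generalizing x with
  | nil => rfl
  | cons g C ih =>
    rw [run_cons, ih (fun g' hg' => h g' (List.mem_cons_of_mem _ hg')),
      g.act_of_ne _ fun hg => hw (h g List.mem_cons_self w hg)]

theorem Within.run_congr {C : List (Gate W)} {L : List W} (h : Within C L) {x y : W → Bool}
    (hxy : ∀ w ∈ L, x w = y w) {w : W} (hw : x w = y w) : run C x w = run C y w := by
  induction C generalizing x y w with
  | nil => exact hw
  | cons g C ih =>
    have hg : ∀ v ∈ g.support, x v = y v := fun v hv => hxy v (h g List.mem_cons_self v hv)
    exact ih (fun g' hg' => h g' (List.mem_cons_of_mem _ hg'))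
      (fun v hv => g.act_congr (hxy v hv) hg) (g.act_congr hw hg)

/-- The gates of `C` and those of `D` act on different qubits. -/
def Apart (C D : List (Gate W)) : Prop := ∀ g ∈ C, ∀ h ∈ D, Disjoint g.support h.support

theorem Within.apart {C D : List (Gate W)} {L L' : List W} (h : Within C L) (h' : Within D L')
    (hd : ∀ w ∈ L, w ∉ L') : Apart C D := fun g hg g' hg' =>
  Finset.disjoint_left.2 fun w hw hw' => hd w (h g hg w hw) (h' g' hg' w hw')

theorem run_act_comm (g : Gate W) (D : List (Gate W))
    (h : ∀ g' ∈ D, Disjoint g.support g'.support) (x : W → Bool) :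
    run D (g.act x) = g.act (run D x) := by
  induction D generalizing x with
  | nil => rfl
  | cons g' D ih =>
    rw [run_cons, run_cons, ← Gate.act_comm g g' (h g' List.mem_cons_self),
      ih fun k hk => h k (List.mem_cons_of_mem _ hk)]

theorem Apart.run_comm {C D : List (Gate W)} (h : Apart C D) (x : W → Bool) :
    run D (run C x) = run C (run D x) := by
  induction C generalizing x with
  | nil => rfl
  | cons g C ih =>
    rw [run_cons, run_cons, ih fun k hk => h k (List.mem_cons_of_mem _ hk),
      run_act_comm g D (h g List.mem_cons_self)]

/-- The gates of `C` can be rearranged into `d` layers without changing the action. -/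
def Sched (C : List (Gate W)) (d : ℕ) : Prop :=
  ∃ ls : List (List (Gate W)), ls.length ≤ d ∧
    (∀ l ∈ ls, l.Pairwise fun g h => Disjoint g.support h.support) ∧
    ls.flatten.Perm C ∧ ∀ x, run ls.flatten x = run C x

theorem Sched.mono {C : List (Gate W)} {d d' : ℕ} (h : Sched C d) (hd : d ≤ d') : Sched C d' :=
  let ⟨ls, h1, h2⟩ := h
  ⟨ls, h1.trans hd, h2⟩

theorem Sched.of_pairwise {C : List (Gate W)}
    (h : C.Pairwise fun g h => Disjoint g.support h.support) : Sched C 1 :=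
  ⟨[C], by simp, by simpa using h, by simp, by simp⟩

theorem Sched.append {C D : List (Gate W)} {c d : ℕ} (hC : Sched C c) (hD : Sched D d) :
    Sched (C ++ D) (c + d) := by
  obtain ⟨ls, h1, h2, h3, h4⟩ := hC
  obtain ⟨ms, k1, k2, k3, k4⟩ := hD
  refine ⟨ls ++ ms, by simp; omega, fun l hl => (List.mem_append.1 hl).elim (h2 l) (k2 l), ?_, ?_⟩
  · simpa using h3.append k3
  · simp [h4, k4]

theorem Sched.nil : Sched ([] : List (Gate W)) 0 := ⟨[], by simp, by simp, by simp, by simp⟩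

theorem Sched.of_length (C : List (Gate W)) : Sched C C.length := by
  induction C with
  | nil => exact Sched.nil
  | cons g C ih =>
    have : Sched [g] 1 := Sched.of_pairwise (by simp)
    exact (this.append ih).mono (by simp; omega)

/-- Gates are involutions, so reversing the layers gives the inverse of the scheduled circuit, which
is also the action of `C.reverse`. -/
theorem Sched.reverse {C : List (Gate W)} {d : ℕ} (h : Sched C d) : Sched C.reverse d := by
  obtain ⟨ls, h1, h2, h3, h4⟩ := h
  have e : ((ls.map List.reverse).reverse).flatten = ls.flatten.reverse := by
    rw [List.reverse_flatten]
  refine ⟨(ls.map List.reverse).reverse, by simpa using h1, ?_, ?_, fun x => ?_⟩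
  · intro l hl
    simp only [List.mem_reverse, List.mem_map] at hl
    obtain ⟨m, hm, rfl⟩ := hl
    rw [List.pairwise_reverse]
    exact (h2 m hm).imp fun h => h.symm
  · rw [e]
    exact (List.reverse_perm _).trans (h3.trans (List.reverse_perm _).symm)
  · rw [e]
    conv_lhs => rw [← run_run_reverse C x, ← h4, run_reverse_run]

/-- Two sequences of layers executed simultaneously. -/
def mergeLayers : List (List (Gate W)) → List (List (Gate W)) → List (List (Gate W))
  | [], ms => ms
  | ls, [] => ls
  | l :: ls, m :: ms => (l ++ m) :: mergeLayers ls ms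

theorem mergeLayers_spec (ls ms : List (List (Gate W))) (h : Apart ls.flatten ms.flatten)
    (hl : ∀ l ∈ ls, l.Pairwise fun g h => Disjoint g.support h.support)
    (hm : ∀ l ∈ ms, l.Pairwise fun g h => Disjoint g.support h.support) :
    (mergeLayers ls ms).length ≤ max ls.length ms.length ∧
    (∀ l ∈ mergeLayers ls ms, l.Pairwise fun g h => Disjoint g.support h.support) ∧
    (mergeLayers ls ms).flatten.Perm (ls.flatten ++ ms.flatten) ∧
    ∀ x, run (mergeLayers ls ms).flatten x = run (ls.flatten ++ ms.flatten) x := by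
  induction ls generalizing ms with
  | nil => exact ⟨by simp [mergeLayers], by simpa [mergeLayers] using hm, by simp [mergeLayers],
      by simp [mergeLayers]⟩
  | cons l ls ih =>
    cases ms with
    | nil => exact ⟨by simp [mergeLayers], by simpa [mergeLayers] using hl, by simp [mergeLayers],
        by simp [mergeLayers]⟩
    | cons m ms =>
      obtain ⟨i1, i2, i3, i4⟩ := ih ms
        (fun g hg k hk => h g (by simp only [List.flatten_cons, List.mem_append]; exact .inr hg) k
          (by simp only [List.flatten_cons, List.mem_append]; exact .inr hk))
        (fun l' hl' => hl l' (List.mem_cons_of_mem _ hl'))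
        (fun l' hl' => hm l' (List.mem_cons_of_mem _ hl'))
      have hmls : Apart ls.flatten m := fun g hg k hk =>
        h g (by simp only [List.flatten_cons, List.mem_append]; exact .inr hg) k
          (by simp only [List.flatten_cons, List.mem_append]; exact .inl hk)
      refine ⟨by simp only [mergeLayers, List.length_cons]; omega, ?_, ?_, ?_⟩
      · intro l' hl'
        rcases List.mem_cons.1 hl' with rfl | hl'
        · rw [List.pairwise_append]
          exact ⟨hl l List.mem_cons_self, hm m List.mem_cons_self, fun g hg k hk =>
            h g (by simp only [List.flatten_cons, List.mem_append]; exact .inl hg) k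
              (by simp only [List.flatten_cons, List.mem_append]; exact .inl hk)⟩
        · exact i2 l' hl'
      · simp only [mergeLayers, List.flatten_cons, List.append_assoc]
        refine List.Perm.append_left l ?_
        refine (i3.append_left m).trans ?_
        rw [← List.append_assoc, ← List.append_assoc]
        exact List.perm_append_comm.append_right _
      · intro x
        simp only [mergeLayers, List.flatten_cons, run_append, i4]
        rw [hmls.run_comm]

theorem Sched.par {C D : List (Gate W)} {d : ℕ} (hC : Sched C d) (hD : Sched D d)
    (h : Apart C D) : Sched (C ++ D) d := by
  obtain ⟨ls, h1, h2, h3, h4⟩ := hC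
  obtain ⟨ms, k1, k2, k3, k4⟩ := hD
  obtain ⟨i1, i2, i3, i4⟩ := mergeLayers_spec ls ms
    (fun g hg k hk => h g (h3.mem_iff.1 hg) k (k3.mem_iff.1 hk)) h2 k2
  exact ⟨_, i1.trans (max_le h1 k1), i2, i3.trans (h3.append k3), fun x => by simp [i4, h4, k4]⟩

/-- The circuit flips the bit `t` if `f` holds, and changes nothing else. -/
def Toggles (C : List (Gate W)) (t : W) (f : (W → Bool) → Bool) : Prop :=
  ∀ x, run C x = Function.update x t (xor (x t) (f x))

/-- `x w₁ ∧ (e₁ ⊕ x w₂ ∧ (e₂ ⊕ ⋯ b))` for the list of the `(wᵢ, eᵢ)`. -/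
def val (b : Bool) (l : List (W × Bool)) (x : W → Bool) : Bool :=
  l.foldr (fun p r => x p.1 && xor p.2 r) b

@[simp] theorem val_nil (b : Bool) (x : W → Bool) : val b [] x = b := rfl

@[simp] theorem val_cons (b : Bool) (p : W × Bool) (l : List (W × Bool)) (x : W → Bool) :
    val b (p :: l) x = (x p.1 && xor p.2 (val b l x)) := rfl

/-- The conjunction of the bits of the list. -/
def ones (l : List (W × Bool)) (x : W → Bool) : Bool := l.all fun p => x p.1

theorem ones_eq_true {l : List (W × Bool)} {x : W → Bool} :
    ones l x = true ↔ ∀ w ∈ l.map Prod.fst, x w = true := by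
  simp only [ones, List.all_eq_true, List.forall_mem_map]

/-- A block acts on the value r of what follows by the affine map r ↦ val ⊕ (ones ∧ r), and
concatenation composes these maps. Hence the two bits `ones` and `val` of each block suffice for a
balanced tree. -/
theorem val_append (l m : List (W × Bool)) (x : W → Bool) :
    val false (l ++ m) x = xor (val false l x) (ones l x && val false m x) := by
  induction l with
  | nil => simp [ones]
  | cons p l ih =>
    rw [List.cons_append, val_cons, val_cons, ih]
    simp only [ones, List.all_cons]
    cases x p.1 <;> simp

theorem val_true_zero (l : List (W × Bool)) (x : W → Bool) :
    val true (l.map fun p => (p.1, false)) x = ones l x := by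
  induction l with
  | nil => rfl
  | cons p l ih => simp [ih, ones]

theorem val_congr {b : Bool} {l : List (W × Bool)} {x y : W → Bool}
    (h : ∀ w ∈ l.map Prod.fst, x w = y w) : val b l x = val b l y := by
  induction l with
  | nil => rfl
  | cons p l ih =>
    rw [val_cons, val_cons, h p.1 (by simp), ih fun w hw => h w (by simp at hw ⊢; tauto)]

theorem ones_congr {l : List (W × Bool)} {x y : W → Bool}
    (h : ∀ w ∈ l.map Prod.fst, x w = y w) : ones l x = ones l y := by
  rw [← val_true_zero, ← val_true_zero]
  exact val_congr (by simpa using h)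

end Basics

/-! ### Evaluation with dirty qubits, and by a tree on a clean workspace -/

section Toggle

set_option linter.unusedSectionVars false

variable {W : Type} [Fintype W] [DecidableEq W]

theorem val_update {b : Bool} {l : List (W × Bool)} {x : W → Bool} {t : W} {v : Bool}
    (h : t ∉ l.map Prod.fst) : val b l (Function.update x t v) = val b l x :=
  val_congr fun w hw => Function.update_of_ne (fun e => h (by rwa [← e])) _ _

theorem ones_update {l : List (W × Bool)} {x : W → Bool} {t : W} {v : Bool}
    (h : t ∉ l.map Prod.fst) : ones l (Function.update x t v) = ones l x :=
  ones_congr fun w hw => Function.update_of_ne (fun e => h (by rwa [← e])) _ _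

theorem Within.run_update {C : List (Gate W)} {L : List W} (h : Within C L) {t : W} (ht : t ∉ L)
    (x : W → Bool) (v : Bool) :
    run C (Function.update x t v) = Function.update (run C x) t v := by
  funext w
  by_cases e : w = t
  · subst e
    rw [h.run_of_notMem _ ht, Function.update_self, Function.update_self]
  · rw [Function.update_of_ne e]
    exact h.run_congr (fun w hw => Function.update_of_ne (fun e => ht (by rwa [← e])) _ _)
      (Function.update_of_ne e _ _)

/-- A gate list for `t ↦ t ⊕ (e ∧ a)` with a constant `e`. -/
theorem exists_cnot (e : Bool) {a t : W} (h : t ≠ a) : ∃ C : List (Gate W),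
    (∀ x, run C x = Function.update x t (xor (x t) (x a && e))) ∧
    Within C [a, t] ∧ C.length ≤ 1 := by
  cases e with
  | false => exact ⟨[], by simp, Within.nil _, by simp⟩
  | true =>
    exact ⟨[Gate.cnot a t h], by simp [Gate.cnot_act], by simp [Within], by simp⟩

theorem exists_toggle_val_nil (b : Bool) (t : W) : ∃ C : List (Gate W),
    Toggles C t (val b []) ∧ Within C [t] ∧ C.length ≤ 1 := by
  cases b with
  | false => exact ⟨[], fun x => by simp, Within.nil _, by simp⟩
  | true =>
    exact ⟨[Gate.notGate t], fun x => by simp [Gate.notGate_act], by simp [Within], by simp⟩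

/-- With one dirty qubit `d`, exponentially many gates suffice. -/
theorem exists_toggle_val_of_dirty (b : Bool) (l : List (W × Bool)) (t d : W) (htd : t ≠ d)
    (ht : t ∉ l.map Prod.fst) (hd : d ∉ l.map Prod.fst) : ∃ C : List (Gate W),
    Toggles C t (val b l) ∧ Within C (t :: d :: l.map Prod.fst) ∧
    C.length + 3 ≤ 4 * 2 ^ l.length := by
  induction l generalizing t d with
  | nil =>
    obtain ⟨C, h1, h2, h3⟩ := exists_toggle_val_nil b t
    exact ⟨C, h1, h2.mono (by simp), by simp; omega⟩
  | cons p l ih =>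
    simp only [List.map_cons, List.mem_cons, not_or] at ht hd
    obtain ⟨D, h1, h2, h3⟩ := ih d t htd.symm hd.2 ht.2
    obtain ⟨E, k1, k2, k3⟩ := exists_cnot p.2 ht.1
    -- The two Toffolis see `d` before and after it is toggled, so the unknown value of `d` cancels
    -- in `t`; the second `D` restores `d`. The recursive `D` borrows `t` as its dirty qubit.
    refine ⟨Gate.toffoli p.1 d t ht.1 htd :: (D ++ Gate.toffoli p.1 d t ht.1 htd :: (D ++ E)),
      fun x => ?_, ?_, ?_⟩
    · simp only [run_cons, run_append, h1 _, Gate.toffoli_act, k1, val_cons]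
      have hp : p.1 ≠ t := Ne.symm ht.1
      have hp' : p.1 ≠ d := Ne.symm hd.1
      funext w
      simp only [val_update hd.2, val_update ht.2]
      by_cases e : w = t
      · subst e
        simp only [Function.update_self, Function.update_of_ne htd,
          Function.update_of_ne htd.symm, Function.update_of_ne hp, Function.update_of_ne hp']
        cases x p.1 <;> cases x d <;> cases x w <;> cases val b l x <;> cases p.2 <;> rfl
      · by_cases e' : w = d
        · subst e'
          simp [e]
        · simp [e, e']
    · refine Within.cons (by simp) (Within.append (h2.mono (by simp; tauto))
        (Within.cons (by simp) (Within.append (h2.mono (by simp; tauto)) (k2.mono (by simp)))))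
    · simp only [List.length_cons, List.length_append, pow_succ]
      omega

/-- A Toffoli before and after the recursive call cancels the unknown value of the next dirty qubit.
Restoring `us` is not demanded, so one recursive call per level suffices and the size is linear; the
caller undoes the changes by the reversed circuit. -/
theorem exists_ladder (b : Bool) (l : List (W × Bool)) (u : W) (us : List W)
    (hl : us.length = l.length) (hn : (l.map Prod.fst ++ u :: us).Nodup) : ∃ C : List (Gate W),
    Within C (l.map Prod.fst ++ u :: us) ∧ C.length ≤ 3 * l.length + 1 ∧
    ∀ x, (∀ w ∉ u :: us, run C x w = x w) ∧ run C x u = xor (x u) (val b l x) := by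
  induction l generalizing u us with
  | nil =>
    obtain ⟨C, h1, h2, h3⟩ := exists_toggle_val_nil b u
    refine ⟨C, h2.mono (by simp), by simpa using h3, fun x => ⟨fun w hw => ?_, ?_⟩⟩
    · exact h2.run_of_notMem x (by simp at hw ⊢; tauto)
    · rw [h1]; simp
  | cons p l ih =>
    obtain _ | ⟨u', us⟩ := us
    · simp at hl
    have hu : u ∉ l.map Prod.fst ++ u' :: us := by grind
    have hup : u ≠ p.1 := by grind
    have huu : u ≠ u' := by grind
    have hp : p.1 ∉ u' :: us := by grind
    have hlu : u ∉ l.map Prod.fst := by grind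
    obtain ⟨D, h1, h2, h3⟩ := ih u' us (by simpa using hl) (by grind)
    obtain ⟨E, k1, k2, k3⟩ := exists_cnot p.2 hup
    refine ⟨Gate.toffoli p.1 u' u hup huu :: (D ++ Gate.toffoli p.1 u' u hup huu :: E), ?_, ?_,
      fun x => ⟨fun w hw => ?_, ?_⟩⟩
    · exact Within.cons (by simp) (Within.append (h1.mono (by simp; tauto))
        (Within.cons (by simp) (k2.mono (by simp))))
    · simp only [List.length_cons, List.length_append]
      omega
    · simp only [List.mem_cons, not_or] at hw
      simp only [run_cons, run_append, Gate.toffoli_act, k1, h1.run_update hu]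
      simp only [ne_eq, hw.1, not_false_eq_true, Function.update_of_ne]
      exact (h3 x).1 w (by simp [hw.2])
    · simp only [run_cons, run_append, Gate.toffoli_act, k1, h1.run_update hu]
      simp only [Function.update_self, Function.update_of_ne hup.symm,
        Function.update_of_ne huu.symm, (h3 x).1 _ hp, (h3 x).2, val_cons]
      cases x p.1 <;> cases x u' <;> cases x u <;> cases val b l x <;> cases p.2 <;> rfl

/-- With as many dirty qubits as there are bits, linearly many gates suffice. -/
theorem exists_toggle_val_of_ladder (b : Bool) (l : List (W × Bool)) (t : W) (us : List W)
    (hl : us.length = l.length) (hn : (l.map Prod.fst ++ t :: us).Nodup) : ∃ C : List (Gate W),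
    Toggles C t (val b l) ∧ Within C (l.map Prod.fst ++ t :: us) ∧
    C.length ≤ 6 * l.length + 1 := by
  obtain _ | ⟨p, l⟩ := l
  · obtain ⟨C, h1, h2, h3⟩ := exists_toggle_val_nil b t
    exact ⟨C, h1, h2.mono (by simp), by simpa using h3⟩
  obtain _ | ⟨u, us⟩ := us
  · simp at hl
  have hu : t ∉ l.map Prod.fst ++ u :: us := by grind
  have hup : t ≠ p.1 := by grind
  have huu : t ≠ u := by grind
  have hp : p.1 ∉ u :: us := by grind
  obtain ⟨D, h1, h2, h3⟩ := exists_ladder b l u us (by simpa using hl) (by grind)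
  obtain ⟨E, k1, k2, k3⟩ := exists_cnot p.2 hup
  refine ⟨Gate.toffoli p.1 u t hup huu :: (D ++ Gate.toffoli p.1 u t hup huu :: (D.reverse ++ E)),
    fun x => ?_, ?_, ?_⟩
  · simp only [run_cons, run_append, Gate.toffoli_act, k1, h1.run_update hu,
      h1.reverse.run_update hu, run_reverse_run]
    funext w
    by_cases e : w = t
    · subst e
      simp only [Function.update_self, Function.update_of_ne hup.symm,
        Function.update_of_ne huu.symm, (h3 x).1 _ hp, (h3 x).2, val_cons]
      cases x p.1 <;> cases x u <;> cases x w <;> cases val b l x <;> cases p.2 <;> rfl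
    · simp [e]
  · exact Within.cons (by simp) (Within.append (h1.mono (by simp; tauto))
      (Within.cons (by simp) (Within.append (h1.reverse.mono (by simp; tauto))
        (k2.mono (by simp)))))
  · simp only [List.length_cons, List.length_append, List.length_reverse]
    omega

theorem nodup_split {a b c d : List W} {r : W} (h : ((a ++ b) ++ r :: (c ++ d)).Nodup) :
    (a ++ c).Nodup ∧ (b ++ d).Nodup ∧ r ∉ a ++ c ∧ r ∉ b ++ d ∧ ∀ w ∈ a ++ c, w ∉ b ++ d := by
  simp only [List.nodup_append, List.nodup_cons, List.mem_append, List.mem_cons] at h ⊢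
  grind

/-- On a block `l` of qubits, with qubits `ws` that are in the state `1` as workspace: a circuit
of logarithmic depth for the conjunction and for the value of the block. -/
theorem exists_tree (h : ℕ) (l : List (W × Bool)) (ws : List W) (hl : l.length ≤ 8 * 2 ^ h)
    (hw : 4 * 2 ^ h ≤ ws.length + 1) (hn : (l.map Prod.fst ++ ws).Nodup) :
    ∃ (C : List (Gate W)) (p g : W), p ∈ ws ∧ g ∈ ws ∧ p ≠ g ∧
    Within C (l.map Prod.fst ++ ws) ∧ C.length + 3 ≤ 3000 * 2 ^ h ∧ Sched C (3000 + 3 * h) ∧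
    ∀ x, (∀ w ∈ ws, x w = true) → run C x p = ones l x ∧ run C x g = val false l x := by
  induction h generalizing l ws with
  | zero =>
    -- At most eight bits: `p` and `g` receive the two results, and `u` is the borrowed qubit of the
    -- exponential construction, whose size is bounded here.
    obtain _ | ⟨p, _ | ⟨g, _ | ⟨u, ws⟩⟩⟩ := ws
    · simp at hw
    · simp at hw
    · simp at hw
    have hpg : p ≠ g := by grind
    have hpu : p ≠ u := by grind
    have hgu : g ≠ u := by grind
    have hp : p ∉ l.map Prod.fst := by grind
    have hg : g ∉ l.map Prod.fst := by grind
    have hu : u ∉ l.map Prod.fst := by grind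
    have ez : (l.map fun p => (p.1, false)).map Prod.fst = l.map Prod.fst := by simp
    obtain ⟨D, h1, h2, h3⟩ := exists_toggle_val_of_dirty true (l.map fun p => (p.1, false)) p u hpu
      (by rwa [ez]) (by rwa [ez])
    obtain ⟨E, k1, k2, k3⟩ := exists_toggle_val_of_dirty false l g u hgu hg hu
    rw [ez] at h2
    have hpow : 2 ^ l.length ≤ 2 ^ 8 := Nat.pow_le_pow_right (by norm_num) (by simpa using hl)
    rw [List.length_map] at h3
    have hlen : (Gate.notGate p :: Gate.notGate g :: (D ++ E)).length + 3 ≤ 3000 := by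
      simp only [List.length_cons, List.length_append]
      omega
    refine ⟨Gate.notGate p :: Gate.notGate g :: (D ++ E), p, g, by simp, by simp, hpg, ?_,
      by simpa using hlen, (Sched.of_length _).mono (by omega), fun x hx => ?_⟩
    · exact Within.cons (by simp) (Within.cons (by simp)
        ((h2.mono (by simp; tauto)).append (k2.mono (by simp; tauto))))
    · have h1' := fun x => h1 x
      simp only [val_true_zero] at h1'
      simp only [run_cons, run_append, Gate.notGate_act, h1', k1 _, ones_update hp,
        ones_update hg, val_update hp, val_update hg]
      simp [hpg, hpg.symm, hx]
  | succ h ih =>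
    obtain _ | ⟨r, ws⟩ := ws
    · have : 0 < 2 ^ h := by positivity
      simp only [List.length_nil, pow_succ] at hw
      omega
    have hpos : 0 < 2 ^ h := by positivity
    simp only [List.length_cons, pow_succ] at hw hl
    obtain ⟨l₁, l₂, hl12, hl₁, hl₂⟩ : ∃ l₁ l₂, l = l₁ ++ l₂ ∧ l₁.length ≤ 8 * 2 ^ h ∧
        l₂.length ≤ 8 * 2 ^ h := ⟨l.take (8 * 2 ^ h), l.drop (8 * 2 ^ h),
      (List.take_append_drop _ _).symm, by simp, by simp; omega⟩
    -- Two workspaces of size 4 · 2 ^ h - 1 and the extra qubit `r` make up 4 · 2 ^ (h + 1) - 1.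
    obtain ⟨v₁, v₂, hv12, hv₁, hv₂⟩ : ∃ v₁ v₂, ws = v₁ ++ v₂ ∧ 4 * 2 ^ h ≤ v₁.length + 1 ∧
        4 * 2 ^ h ≤ v₂.length + 1 := ⟨ws.take (4 * 2 ^ h - 1), ws.drop (4 * 2 ^ h - 1),
      (List.take_append_drop _ _).symm, by simp; omega, by simp; omega⟩
    subst hl12 hv12
    rw [List.map_append] at hn
    obtain ⟨hn₁, hn₂, hr₁, hr₂, hdis⟩ := nodup_split hn
    obtain ⟨C₁, p₁, g₁, hp₁, hg₁, hpg₁, w₁, s₁, d₁, f₁⟩ := ih l₁ v₁ hl₁ hv₁ hn₁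
    obtain ⟨C₂, p₂, g₂, hp₂, hg₂, hpg₂, w₂, s₂, d₂, f₂⟩ := ih l₂ v₂ hl₂ hv₂ hn₂
    have hp₁m : p₁ ∈ l₁.map Prod.fst ++ v₁ := List.mem_append_right _ hp₁
    have hg₁m : g₁ ∈ l₁.map Prod.fst ++ v₁ := List.mem_append_right _ hg₁
    have hp₂m : p₂ ∈ l₂.map Prod.fst ++ v₂ := List.mem_append_right _ hp₂
    have hg₂m : g₂ ∈ l₂.map Prod.fst ++ v₂ := List.mem_append_right _ hg₂
    have a1 : g₁ ≠ p₁ := hpg₁.symm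
    have a2 : g₁ ≠ g₂ := fun e => hdis _ hg₁m (e ▸ hg₂m)
    have a3 : r ≠ p₁ := fun e => hr₁ (e ▸ hp₁m)
    have a4 : r ≠ p₂ := fun e => hr₂ (e ▸ hp₂m)
    have a5 : r ≠ g₁ := fun e => hr₁ (e ▸ hg₁m)
    have a6 : g₁ ≠ p₂ := fun e => hdis _ hg₁m (e ▸ hp₂m)
    -- The affine maps of the halves are composed: the value is accumulated in `g₁`, while the
    -- conjunction goes to `r`, which is first cleared from 1 to 0.
    refine ⟨(C₁ ++ C₂) ++ [Gate.toffoli p₁ g₂ g₁ a1 a2, Gate.notGate r,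
      Gate.toffoli p₁ p₂ r a3 a4], r, g₁, by simp, ?_, a5, ?_, ?_, ?_, fun x hx => ?_⟩
    · simp [hg₁]
    · refine ((w₁.mono (by simp; tauto)).append (w₂.mono (by simp; tauto))).append ?_
      exact Within.cons (by simp [hp₁, hg₁, hg₂]) (Within.cons (by simp)
        (Within.cons (by simp [hp₁, hp₂]) (Within.nil _)))
    · simp only [List.length_append, List.length_cons, List.length_nil, pow_succ]
      omega
    · exact ((d₁.par d₂ (w₁.apart w₂ hdis)).append (Sched.of_length _)).mono (by simp; omega)
    · have hx₁ : ∀ w ∈ v₁, x w = true := fun w hw => hx w (by simp [hw])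
      have hx₂ : ∀ w ∈ v₂, run C₁ x w = true := fun w hw => by
        rw [w₁.run_of_notMem x fun h => hdis w h (by simp [hw])]
        exact hx w (by simp [hw])
      have hc : ∀ w ∈ l₂.map Prod.fst, run C₁ x w = x w := fun w hw =>
        w₁.run_of_notMem x fun h => hdis w h (List.mem_append_left _ hw)
      obtain ⟨e1, e2⟩ := f₁ x hx₁
      obtain ⟨e3, e4⟩ := f₂ _ hx₂
      rw [ones_congr hc] at e3
      rw [val_congr hc] at e4
      have e5 : run C₂ (run C₁ x) p₁ = ones l₁ x := by
        rw [w₂.run_of_notMem _ (hdis _ hp₁m), e1]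
      have e6 : run C₂ (run C₁ x) g₁ = val false l₁ x := by
        rw [w₂.run_of_notMem _ (hdis _ hg₁m), e2]
      have e7 : run C₂ (run C₁ x) r = true := by
        rw [w₂.run_of_notMem _ hr₂, w₁.run_of_notMem _ hr₁, hx r (by simp)]
      simp only [run_append, run_cons, run_nil, Gate.toffoli_act, Gate.notGate_act]
      rw [val_append]
      constructor
      · simp [a3.symm, a4.symm, a5, a1.symm, a6.symm, e5, e3, e7, ones]
      · simp [a5.symm, e4, e5, e6]

end Toggle

/-! ### Blocks of doubling size that serve each other as workspace -/

section Stages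

set_option linter.unusedSectionVars false

variable {W : Type} [Fintype W] [DecidableEq W]

/-- The circuit adds `φ x` to `x`, where `φ x` lives on the bits `T` and depends only on the
bits `D`. -/
structure Adds (C : List (Gate W)) (T D : List W) (φ : (W → Bool) → W → Bool) : Prop where
  run_eq : ∀ x w, run C x w = xor (x w) (φ x w)
  off : ∀ x w, w ∉ T → φ x w = false
  congr : ∀ x y, (∀ w ∈ D, x w = y w) → φ x = φ y

theorem Adds.nil (T D : List W) : Adds ([] : List (Gate W)) T D fun _ _ => false :=
  ⟨by simp, by simp, by simp⟩

theorem Adds.mono {C : List (Gate W)} {T D T' D' : List W} {φ : (W → Bool) → W → Bool}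
    (h : Adds C T D φ) (hT : ∀ w ∈ T, w ∈ T') (hD : ∀ w ∈ D, w ∈ D') : Adds C T' D' φ :=
  ⟨h.run_eq, fun x w hw => h.off x w fun hw' => hw (hT w hw'),
    fun x y hxy => h.congr x y fun w hw => hxy w (hD w hw)⟩

theorem Adds.append {C C' : List (Gate W)} {T D : List W} {φ φ' : (W → Bool) → W → Bool}
    (h : Adds C T D φ) (h' : Adds C' T D φ') (hd : ∀ w ∈ D, w ∉ T) :
    Adds (C ++ C') T D fun x w => xor (φ x w) (φ' x w) := by
  refine ⟨fun x w => ?_, fun x w hw => by simp [h.off x w hw, h'.off x w hw], fun x y hxy => ?_⟩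
  · rw [run_append, h'.run_eq, h.run_eq, h'.congr (run C x) x fun v hv => by
      rw [h.run_eq, h.off x v (hd v hv), Bool.xor_false], Bool.xor_assoc]
  · simp only [h.congr x y hxy, h'.congr x y hxy]

/-- Run the tree, copy its two results to `c` and `k`, and undo the tree. Even if the workspace is
not all 1, only `c` and `k` change, by some function of the block and the workspace; this is what
makes later masking possible. -/
theorem exists_block (h : ℕ) (l : List (W × Bool)) (ws : List W) (c k : W)
    (hl : l.length ≤ 8 * 2 ^ h) (hw : 4 * 2 ^ h ≤ ws.length + 1)
    (hn : (l.map Prod.fst ++ ws).Nodup) (hc : c ∉ l.map Prod.fst ++ ws)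
    (hk : k ∉ l.map Prod.fst ++ ws) (hck : c ≠ k) :
    ∃ (C : List (Gate W)) (φ : (W → Bool) → W → Bool), Adds C [c, k] (l.map Prod.fst ++ ws) φ ∧
    Within C (c :: k :: (l.map Prod.fst ++ ws)) ∧ C.length ≤ 6000 * 2 ^ h ∧
    Sched C (6002 + 6 * h) ∧
    ∀ x, (∀ w ∈ ws, x w = true) → φ x c = ones l x ∧ φ x k = val false l x := by
  obtain ⟨M, p, g, hp, hg, hpg, w₁, s₁, d₁, f₁⟩ := exists_tree h l ws hl hw hn
  have hcp : c ≠ p := fun e => hc (e ▸ List.mem_append_right _ hp)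
  have hkg : k ≠ g := fun e => hk (e ▸ List.mem_append_right _ hg)
  have hcg : c ≠ g := fun e => hc (e ▸ List.mem_append_right _ hg)
  refine ⟨M ++ ([Gate.cnot p c hcp, Gate.cnot g k hkg] ++ M.reverse),
    fun x w => if w = c then run M x p else if w = k then run M x g else false,
    ⟨fun x w => ?_, fun x w hw => ?_, fun x y hxy => ?_⟩, ?_, ?_, ?_, fun x hx => ?_⟩
  · simp only [run_append, run_cons, run_nil, Gate.cnot_act, w₁.reverse.run_update hc,
      w₁.reverse.run_update hk, run_reverse_run]
    by_cases e : w = c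
    · subst e
      simp [hck, w₁.run_of_notMem x hc]
    · by_cases e' : w = k
      · subst e'
        simp [e, hcg.symm, w₁.run_of_notMem x hk]
      · simp [e, e']
  · simp only [List.mem_cons, List.not_mem_nil, or_false, not_or] at hw
    simp [hw.1, hw.2]
  · funext w
    rw [w₁.run_congr hxy (hxy p (List.mem_append_right _ hp)),
      w₁.run_congr hxy (hxy g (List.mem_append_right _ hg))]
  · have hM := w₁.mono (L' := c :: k :: (l.map Prod.fst ++ ws)) fun w hw => by
      simp only [List.mem_cons]; exact .inr (.inr hw)
    exact hM.append (Within.append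
      (Within.cons (by simp [hp]) (Within.cons (by simp [hg]) (Within.nil _))) hM.reverse)
  · simp only [List.length_append, List.length_cons, List.length_nil, List.length_reverse]
    omega
  · exact (d₁.append ((Sched.of_length _).append d₁.reverse)).mono (by simp; omega)
  · obtain ⟨e1, e2⟩ := f₁ x hx
    simp [hck.symm, e1, e2]

/-- The bits occurring in a list of pairs. -/
def pairBits (cs : List (W × W)) : List W := cs.flatMap fun p => [p.1, p.2]

@[simp] theorem pairBits_nil : pairBits ([] : List (W × W)) = [] := rfl

@[simp] theorem pairBits_cons (p : W × W) (cs : List (W × W)) :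
    pairBits (p :: cs) = p.1 :: p.2 :: pairBits cs := rfl

theorem exists_pairBits (n : ℕ) (L : List W) (h : L.length = 2 * n) :
    ∃ cs : List (W × W), cs.length = n ∧ pairBits cs = L := by
  induction n generalizing L with
  | zero => exact ⟨[], rfl, by simpa using (List.length_eq_zero_iff.1 h).symm⟩
  | succ n ih =>
    obtain _ | ⟨a, _ | ⟨b, L⟩⟩ := L
    · simp at h
    · simp at h; omega
    · obtain ⟨cs, h1, h2⟩ := ih L (by simp at h; omega)
      exact ⟨(a, b) :: cs, by simp [h1], by simp [h2]⟩

theorem length_pairBits (cs : List (W × W)) : (pairBits cs).length = 2 * cs.length := by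
  induction cs with
  | nil => rfl
  | cons p cs ih => simp [ih]; omega

/-- `h₁ ⊕ c₁ ∧ (h₂ ⊕ c₂ ∧ ⋯)` for the list of the pairs `(cᵢ, hᵢ)`. -/
def pairVal (cs : List (W × W)) (x : W → Bool) : Bool :=
  cs.foldr (fun p r => xor (x p.2) (x p.1 && r)) false

@[simp] theorem pairVal_nil (x : W → Bool) : pairVal [] x = false := rfl

@[simp] theorem pairVal_cons (p : W × W) (cs : List (W × W)) (x : W → Bool) :
    pairVal (p :: cs) x = xor (x p.2) (x p.1 && pairVal cs x) := rfl

theorem pairVal_congr {cs : List (W × W)} {x y : W → Bool} (h : ∀ w ∈ pairBits cs, x w = y w) :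
    pairVal cs x = pairVal cs y := by
  induction cs with
  | nil => rfl
  | cons p cs ih =>
    rw [pairVal_cons, pairVal_cons, h p.1 (by simp), h p.2 (by simp),
      ih fun w hw => h w (by simp [hw])]

theorem pairVal_false (cs : List (W × W)) : pairVal cs (fun _ => false) = false := by
  induction cs with
  | nil => rfl
  | cons p cs ih => simp

/-- Horner's scheme in place, from the last pair to the first, with one Toffoli for each pair except
the last. The intermediate bits are overwritten. -/
theorem exists_horner (c k : W) (cs : List (W × W)) (hn : (pairBits ((c, k) :: cs)).Nodup) :
    ∃ C : List (Gate W), Within C (pairBits ((c, k) :: cs)) ∧ C.length ≤ cs.length ∧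
    ∀ x, run C x k = pairVal ((c, k) :: cs) x := by
  induction cs generalizing c k with
  | nil => exact ⟨[], Within.nil _, by simp, by simp⟩
  | cons q cs ih =>
    obtain ⟨c', k'⟩ := q
    rw [pairBits_cons, List.nodup_cons, List.nodup_cons, List.mem_cons, not_or] at hn
    obtain ⟨⟨hck, hc⟩, hk, hn⟩ := hn
    obtain ⟨C, h1, h2, h3⟩ := ih c' k' hn
    have hkk : k ≠ k' := fun e => hk (by simp [e])
    refine ⟨C ++ [Gate.toffoli c k' k (Ne.symm hck) hkk], ?_, by simpa using h2, fun x => ?_⟩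
    · exact (h1.mono (by simp +contextual)).append (Within.cons (by simp) (Within.nil _))
    · rw [run_append, run_cons, run_nil, Gate.toffoli_act, Function.update_self, h3,
        h1.run_of_notMem x hc, h1.run_of_notMem x hk, pairVal_cons (c, k)]

theorem nodup_stage {B R V P : List W} {c k : W}
    (h : ((B ++ R) ++ (V ++ c :: k :: P)).Nodup) :
    (B ++ V).Nodup ∧ c ∉ B ++ V ∧ k ∉ B ++ V ∧ c ≠ k ∧ (R ++ (B ++ P)).Nodup ∧
    (∀ w ∈ c :: k :: (B ++ V), w ∉ R ++ P) ∧ (∀ w ∈ (B ++ R) ++ V, w ∉ c :: k :: P) := by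
  simp only [List.nodup_append, List.nodup_cons, List.mem_append, List.mem_cons] at h ⊢
  grind

/-- The blocks have sizes 8 · 2 ^ j, 8 · 2 ^ (j + 1), …, one for each pair of `cs`, and each uses
its predecessor (the first one uses `V`) as workspace. Blocks at distance two share no qubits, so
all of them fit into two parallel rounds. The round `X₁` contains the first block and `X₂` avoids
`V`, which keeps the recursion going. -/
theorem exists_stages (j : ℕ) (cs : List (W × W)) (rest : List (W × Bool)) (V : List W)
    (hlen : rest.length + 8 * 2 ^ j ≤ 8 * (2 ^ j * 2 ^ cs.length))
    (hV : rest ≠ [] → 4 * 2 ^ j ≤ V.length + 1)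
    (hn : (rest.map Prod.fst ++ (V ++ pairBits cs)).Nodup) :
    ∃ (X₁ X₂ : List (Gate W)) (φ₁ φ₂ : (W → Bool) → W → Bool),
    Adds X₁ (pairBits cs) (rest.map Prod.fst ++ V) φ₁ ∧
    Adds X₂ (pairBits cs) (rest.map Prod.fst) φ₂ ∧
    Within X₁ ((rest.map Prod.fst ++ V) ++ pairBits cs) ∧
    Within X₂ (rest.map Prod.fst ++ pairBits cs) ∧
    X₁.length + X₂.length + 6000 * 2 ^ j ≤ 6000 * (2 ^ j * 2 ^ cs.length) ∧
    Sched X₁ (6002 + 6 * (j + cs.length)) ∧ Sched X₂ (6002 + 6 * (j + cs.length)) ∧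
    ∀ x, (∀ w ∈ V, x w = true) →
      pairVal cs (fun w => xor (φ₁ x w) (φ₂ x w)) = val false rest x := by
  induction cs generalizing j rest V with
  | nil =>
    have : rest = [] := by simpa using hlen
    subst this
    exact ⟨[], [], _, _, Adds.nil _ _, Adds.nil _ _, Within.nil _, Within.nil _, by simp,
      Sched.nil.mono (by simp), Sched.nil.mono (by simp), by simp⟩
  | cons q cs ih =>
    obtain ⟨c, k⟩ := q
    have h2j : 0 < 2 ^ j := by positivity
    have h2j' : 2 ^ j ≤ 2 ^ j * 2 ^ cs.length := Nat.le_mul_of_pos_right _ (by positivity)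
    have e2 : 2 ^ (j + 1) * 2 ^ cs.length = 2 * (2 ^ j * 2 ^ cs.length) := by ring
    have e3 : 2 ^ j * 2 ^ (cs.length + 1) = 2 * (2 ^ j * 2 ^ cs.length) := by ring
    rw [List.length_cons, e3] at hlen ⊢
    by_cases hr : rest = []
    · subst hr
      exact ⟨[], [], _, _, Adds.nil _ _, Adds.nil _ _, Within.nil _, Within.nil _,
        by simp only [List.length_nil]; omega,
        Sched.nil.mono (by simp), Sched.nil.mono (by simp), by simp [pairVal_false]⟩
    -- If anything follows `B`, then `B` is full, and its 8 · 2 ^ j bits exceed the workspace 4 · 2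
    -- ^ (j + 1) - 1 needed by the next block.
    obtain ⟨B, R, hBR, hB, hR, hfull⟩ : ∃ B R, rest = B ++ R ∧ B.length ≤ 8 * 2 ^ j ∧
        R.length + 16 * 2 ^ j ≤ 16 * (2 ^ j * 2 ^ cs.length) ∧
        (R ≠ [] → B.length = 8 * 2 ^ j) := by
      refine ⟨rest.take (8 * 2 ^ j), rest.drop (8 * 2 ^ j), (List.take_append_drop _ _).symm,
        by simp, by simp; omega, fun h => ?_⟩
      have : 0 < (rest.drop (8 * 2 ^ j)).length := List.length_pos_iff.2 h
      rw [List.length_drop] at this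
      simp; omega
    have hV' := hV hr
    subst hBR
    rw [List.map_append, pairBits_cons] at hn
    obtain ⟨n1, n2, n3, n4, n5, n6, n7⟩ := nodup_stage hn
    obtain ⟨O, ψ, o1, o2, o3, o4, o5⟩ := exists_block j B V c k hB hV' n1 n2 n3 n4
    obtain ⟨X₁, X₂, φ₁, φ₂, a1, a2, w1, w2, s, d1, d2, f⟩ := ih (j + 1) R (B.map Prod.fst)
      (by rw [e2, pow_succ]; omega) (fun h => by rw [List.length_map, hfull h, pow_succ]; omega) n5
    rw [e2, pow_succ] at s
    have hoff : ∀ w ∈ [c, k], w ∉ pairBits cs := fun w hw h =>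
      n6 w (by simp at hw ⊢; tauto) (List.mem_append_right _ h)
    -- The rounds swap roles: the recursive `X₁` uses `B` as workspace and must not run beside `O`,
    -- whereas the recursive `X₂` does not touch `B`.
    refine ⟨O ++ X₂, X₁, fun x w => xor (ψ x w) (φ₂ x w), φ₁, ?_, ?_, ?_, ?_, ?_, ?_, ?_,
      fun x hx => ?_⟩
    · rw [List.map_append, pairBits_cons]
      exact (o1.mono (by simp) (by simp; tauto)).append
        (a2.mono (by simp +contextual) (by simp +contextual)) n7
    · rw [List.map_append, pairBits_cons]
      exact a1.mono (by simp +contextual) (by simp; tauto)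
    · rw [List.map_append, pairBits_cons]
      exact (o2.mono (by simp; tauto)).append (w2.mono (by simp; tauto))
    · rw [List.map_append, pairBits_cons]
      exact w1.mono (by simp; tauto)
    · rw [List.length_append]
      omega
    · exact (o4.mono (by omega)).par (d2.mono (by omega)) (o2.apart w2 n6)
    · exact d1.mono (by omega)
    · obtain ⟨g1, g2⟩ := o5 x hx
      have hcs : pairVal cs (fun w => xor (xor (ψ x w) (φ₂ x w)) (φ₁ x w)) =
          pairVal cs (fun w => xor (φ₁ x w) (φ₂ x w)) :=
        pairVal_congr fun w hw => by
          rw [o1.off x w fun h => hoff w h hw, Bool.false_xor, Bool.xor_comm]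
      rw [pairVal_cons, hcs, val_append]
      simp only [a1.off x _ (hoff c (by simp)), a1.off x _ (hoff k (by simp)),
        a2.off x _ (hoff c (by simp)), a2.off x _ (hoff k (by simp)), g1, g2, Bool.xor_false]
      -- If `B` is not all 1, the results of later blocks may be wrong, but they are multiplied by
      -- `ones B x = false`.
      by_cases hB : ones B x = true
      · rw [f x (ones_eq_true.1 hB)]
      · simp [hB]

theorem run_map_notGate (L : List W) (hL : L.Nodup) (x : W → Bool) (w : W) :
    run (L.map Gate.notGate) x w = if w ∈ L then !x w else x w := by
  induction L generalizing x with
  | nil => rfl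
  | cons t L ih =>
    obtain ⟨ht, hL⟩ := List.nodup_cons.1 hL
    rw [List.map_cons, run_cons, ih hL, Gate.notGate_act]
    by_cases e : w = t
    · subst e; simp [ht]
    · simp [e]

theorem within_map_notGate (L : List W) : Within (L.map Gate.notGate) L := by
  intro g hg w hw
  obtain ⟨t, ht, rfl⟩ := List.mem_map.1 hg
  simp at hw
  exact hw ▸ ht

theorem sched_map_notGate (L : List W) (hL : L.Nodup) : Sched (L.map Gate.notGate) 1 := by
  refine Sched.of_pairwise (List.pairwise_map.2 (hL.imp fun h => ?_))
  simpa using h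

/-- If the bits of `V` and those of the pairs are `1`, they are a workspace for the bits `rest`,
which may be exponentially more than the pairs. -/
theorem exists_compute (c k : W) (cs : List (W × W)) (rest : List (W × Bool)) (V : List W)
    (hlen : rest.length + 8 ≤ 8 * 2 ^ (cs.length + 1)) (hV : 3 ≤ V.length)
    (hn : (rest.map Prod.fst ++ (V ++ pairBits ((c, k) :: cs))).Nodup) :
    ∃ M : List (Gate W), Within M (rest.map Prod.fst ++ (V ++ pairBits ((c, k) :: cs))) ∧
    M.length ≤ 6000 * 2 ^ (cs.length + 1) + 3 * (cs.length + 1) ∧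
    Sched M (12005 + 13 * (cs.length + 1)) ∧
    ∀ x, (∀ w ∈ V ++ pairBits ((c, k) :: cs), x w = true) → run M x k = val false rest x := by
  obtain ⟨X₁, X₂, φ₁, φ₂, a1, a2, w1, w2, s, d1, d2, f⟩ := exists_stages 0 ((c, k) :: cs) rest V
    (by simpa using hlen) (fun _ => by simpa using hV) hn
  have hn2 : (pairBits ((c, k) :: cs)).Nodup := by
    rw [List.nodup_append, List.nodup_append] at hn; exact hn.2.1.2.1
  have hd : ∀ w ∈ rest.map Prod.fst ++ V, w ∉ pairBits ((c, k) :: cs) := by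
    rw [← List.append_assoc, List.nodup_append] at hn
    exact fun w hw hw' => hn.2.2 w hw w hw' rfl
  obtain ⟨H, h1, h2, h3⟩ := exists_horner c k cs hn2
  have hX := a1.append (a2.mono (fun w h => h) (D' := rest.map Prod.fst ++ V)
    fun w hw => List.mem_append_left _ hw) hd
  have hlp := length_pairBits ((c, k) :: cs)
  set P := pairBits ((c, k) :: cs) with hP
  have hN := within_map_notGate P
  simp only [List.length_cons, pow_zero, zero_add, one_mul] at s d1 d2 hlp
  -- The result bits are supposed to be 1, so they are cleared before the rounds add to them. On
  -- other inputs the circuit yields junk, which the caller masks.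
  refine ⟨P.map Gate.notGate ++ ((X₁ ++ X₂) ++ H), ?_, ?_, ?_, fun x hx => ?_⟩
  · exact (hN.mono (by simp +contextual)).append (((w1.mono (by simp)).append
      (w2.mono (by simp; tauto))).append (h1.mono (by simp +contextual)))
  · simp only [List.length_append, List.length_map]
    omega
  · exact ((sched_map_notGate P hn2).append
      ((d1.append d2).append (Sched.of_length H))).mono (by omega)
  · rw [run_append, run_append, h3]
    set y := run (P.map Gate.notGate) x with hy
    have hyP : ∀ w ∈ P, y w = false := fun w hw => by
      rw [hy, run_map_notGate P hn2, if_pos hw, hx w (List.mem_append_right _ hw)]; rfl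
    have hyD : ∀ w ∈ rest.map Prod.fst ++ V, y w = x w := fun w hw =>
      hN.run_of_notMem x (hd w hw)
    rw [pairVal_congr fun w hw => by rw [hX.run_eq, hyP w hw, Bool.false_xor]]
    rw [f y fun w hw => by
      rw [hyD w (List.mem_append_right _ hw), hx w (List.mem_append_left _ hw)]]
    exact val_congr fun w hw => hyD w (List.mem_append_left _ hw)

end Stages

/-! ### Masking the computation by the prefix: linear size and logarithmic depth -/

section Assembly

set_option linter.unusedSectionVars false

variable {W : Type} [Fintype W] [DecidableEq W]

/-- Compute, use and uncompute: every qubit of `L` is restored whether or not the assumptions on the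
workspace of `M` hold. -/
theorem toggles_conj {M : List (Gate W)} {L : List W} (hM : Within M L) (d k t : W) (htd : t ≠ d)
    (htk : t ≠ k) (ht : t ∉ L) (hd : d ∉ L) :
    Toggles (M ++ (Gate.toffoli d k t htd htk :: M.reverse)) t fun x => x d && run M x k := by
  intro x
  rw [run_append, run_cons, Gate.toffoli_act, hM.reverse.run_update ht, run_reverse_run,
    hM.run_of_notMem x ht, hM.run_of_notMem x hd]

theorem nodup_parts {V P S R : List W} {t d : W} (h : (((V ++ P) ++ (S ++ R)) ++ [t, d]).Nodup) :
    ((V ++ P) ++ t :: S).Nodup ∧ ((V ++ P) ++ d :: S).Nodup ∧ ((S ++ R) ++ (V ++ P)).Nodup ∧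
    t ≠ d ∧ t ∉ (S ++ R) ++ (V ++ P) ∧ d ∉ (S ++ R) ++ (V ++ P) ∧ t ∉ V ++ P ∧ d ∉ V ++ P := by
  simp only [List.nodup_append, List.nodup_cons, List.mem_append, List.mem_cons] at h ⊢
  grind

theorem four_mul_log_add_le {N : ℕ} (hN : 32 ≤ N) : 4 * Nat.log 2 N + 6 ≤ N := by
  have h5 : 5 ≤ Nat.log 2 N := Nat.le_log_of_pow_le (by norm_num) (by simpa using hN)
  have hp : 2 ^ Nat.log 2 N ≤ N := Nat.pow_log_le_self 2 (by omega)
  have key : ∀ m, 5 ≤ m → 4 * m + 6 ≤ 2 ^ m := by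
    intro m hm
    induction m, hm using Nat.le_induction with
    | base => norm_num
    | succ m hm ih => rw [pow_succ]; omega
  exact (key _ h5).trans hp

/-- With one dirty qubit `d`, linear size and logarithmic depth suffice. -/
theorem exists_toggle_val (l : List (W × Bool)) (t d : W) (hn : (l.map Prod.fst ++ [t, d]).Nodup)
    (hl : 1 ≤ l.length) : ∃ C : List (Gate W), Toggles C t (val false l) ∧
    C.length ≤ 2 ^ 40 * l.length ∧ Sched C (2 ^ 40 * (Nat.log 2 l.length + 1)) := by
  by_cases hN : l.length < 32
  · have h1 : t ≠ d ∧ t ∉ l.map Prod.fst ∧ d ∉ l.map Prod.fst := by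
      simp only [List.nodup_append, List.nodup_cons, List.mem_cons] at hn
      grind
    obtain ⟨C, c1, c2, c3⟩ := exists_toggle_val_of_dirty false l t d h1.1 h1.2.1 h1.2.2
    have : 2 ^ l.length ≤ 2 ^ 32 := Nat.pow_le_pow_right (by norm_num) hN.le
    exact ⟨C, c1, by omega, (Sched.of_length C).mono (by omega)⟩
  rw [not_lt] at hN
  have hL := four_mul_log_add_le hN
  have hL5 : 5 ≤ Nat.log 2 l.length := Nat.le_log_of_pow_le (by norm_num) (by simpa using hN)
  have hp : 2 ^ Nat.log 2 l.length ≤ l.length := Nat.pow_log_le_self 2 (by omega)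
  have hp' : l.length < 2 ^ (Nat.log 2 l.length + 1) := Nat.lt_pow_succ_log_self (by norm_num) _
  set L := Nat.log 2 l.length with hLdef
  set N := l.length with hNdef
  -- The prefix `A` supplies three workspace bits for the first block and `L` pairs of result bits.
  -- The equally long `S` lends dirty qubits to the ladders on `A`; both fit because 4 * L + 6 ≤ N.
  obtain ⟨A, S, R, hAB, hA, hS⟩ : ∃ A S R, l = A ++ (S ++ R) ∧ A.length = 2 * L + 3 ∧
      S.length = 2 * L + 3 := ⟨l.take (2 * L + 3), (l.drop (2 * L + 3)).take (2 * L + 3),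
    (l.drop (2 * L + 3)).drop (2 * L + 3), by simp [List.take_append_drop], by simp; omega,
    by simp; omega⟩
  obtain ⟨V, P, hVP, hV, hP⟩ : ∃ V P, A.map Prod.fst = V ++ P ∧ V.length = 3 ∧
      P.length = 2 * L := ⟨(A.map Prod.fst).take 3, (A.map Prod.fst).drop 3,
    (List.take_append_drop _ _).symm, by simp; omega, by simp; omega⟩
  obtain ⟨cs, hcs, hcsP⟩ := exists_pairBits L P hP
  obtain _ | ⟨⟨c, k⟩, cs⟩ := cs
  · simp at hcs; omega
  rw [List.length_cons] at hcs
  have hkP : k ∈ P := by rw [← hcsP]; simp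
  have hlen : A.length + (S ++ R).length = N := by
    rw [hNdef, hAB]; exact List.length_append.symm
  rw [hAB, List.map_append, List.map_append, hVP] at hn
  obtain ⟨n1, n2, n3, htd, ht, hd, htA, hdA⟩ := nodup_parts hn
  rw [← hVP] at n1 n2
  obtain ⟨C₁, a1, a2, a3⟩ := exists_toggle_val_of_ladder false A t (S.map Prod.fst)
    (by simp [hA, hS]) n1
  have ez : (A.map fun p => (p.1, false)).map Prod.fst = A.map Prod.fst := by simp
  obtain ⟨C₂, b1, b2, b3⟩ := exists_toggle_val_of_ladder true (A.map fun p => (p.1, false)) d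
    (S.map Prod.fst) (by simp [hA, hS]) (by rwa [ez])
  have b1' : Toggles C₂ d (ones A) := fun x => by rw [b1 x, val_true_zero]
  obtain ⟨M, m1, m2, m3, m4⟩ := exists_compute c k cs (S ++ R) V
    (by rw [hcs]; rw [pow_succ] at hp'; omega) (by omega) (by rwa [hcsP, List.map_append])
  rw [hcsP, List.map_append] at m1
  rw [hcsP, ← hVP] at m4
  rw [hcs] at m2 m3
  have htk : t ≠ k := fun e => htA (e ▸ List.mem_append_right _ hkP)
  set F := M ++ (Gate.toffoli d k t htd htk :: M.reverse) with hF
  have f1 : Toggles F t fun x => x d && run M x k := toggles_conj m1 d k t htd htk ht hd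
  have hFlen : F.length ≤ 12001 * 2 ^ L + 6 * L := by
    have : 0 < 2 ^ L := by positivity
    simp only [hF, List.length_append, List.length_cons, List.length_reverse]
    omega
  have hFs : Sched F (24012 + 26 * L) := by
    have : Sched (Gate.toffoli d k t htd htk :: M.reverse) (1 + (12005 + 13 * L)) :=
      (Sched.of_length [Gate.toffoli d k t htd htk]).append m3.reverse
    exact (m3.append this).mono (by omega)
  rw [List.length_map] at b3
  -- `C₁` adds the value of `A` to `t`. The first `F` sees `d ⊕ ones A` and the second sees `d`, so
  -- together they add the computed bit masked by `ones A`, and the two `C₂` restore `d`. This needs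
  -- that `M` touches neither `t` nor `d`.
  refine ⟨C₁ ++ (C₂ ++ (F ++ (C₂ ++ F))), fun x => ?_, ?_, ?_⟩
  · simp only [run_append, a1 _, b1' _, f1 _]
    have hk : k ∈ (S.map Prod.fst ++ R.map Prod.fst) ++ (V ++ P) :=
      List.mem_append_right _ (List.mem_append_right _ hkP)
    have hkd : k ≠ d := fun e => hd (e ▸ hk)
    rw [← hVP] at htA hdA
    simp only [m1.run_update ht, m1.run_update hd, ones_update htA, ones_update hdA,
      Function.update_self, Function.update_of_ne htd, Function.update_of_ne htd.symm,
      Function.update_of_ne htk.symm, Function.update_of_ne hkd]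
    have key : (ones A x && run M x k) = (ones A x && val false (S ++ R) x) := by
      by_cases h : ones A x = true
      · rw [m4 x (ones_eq_true.1 h)]
      · simp [h]
    have hv : val false l x = xor (val false A x) (ones A x && run M x k) := by
      rw [hAB, val_append, key]
    rw [hv]
    funext w
    by_cases e : w = t
    · subst e
      simp only [Function.update_self]
      cases x w <;> cases x d <;> cases ones A x <;> cases run M x k <;> cases val false A x <;> rfl
    · by_cases e' : w = d
      · subst e'
        simp [e]
      · simp [e, e']
  · simp only [List.length_append]
    omega
  · exact ((Sched.of_length C₁).append ((Sched.of_length C₂).append (hFs.append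
      ((Sched.of_length C₂).append hFs)))).mono (by omega)

end Assembly

/-! ### Operators that permute the computational basis -/

section Matrices

theorem basisOp_mul {W : Type} [Fintype W] [DecidableEq W] (f g : (W → Bool) → (W → Bool)) :
    basisOp f * basisOp g = basisOp (f ∘ g) := by
  ext y x
  simp [basisOp, Matrix.mul_apply]

theorem basisOp_id {W : Type} [Fintype W] [DecidableEq W] :
    (basisOp id : Op W) = 1 := by
  ext y x
  simp [basisOp, Matrix.one_apply]

theorem basisOp_injective {W : Type} [Fintype W] {f g : (W → Bool) → (W → Bool)}
    (h : basisOp f = basisOp g) : f = g := by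
  funext x
  by_contra hne
  have := congrFun (congrFun h (f x)) x
  simp [basisOp, hne] at this

theorem opOfGates_eq {W : Type} [Fintype W] [DecidableEq W] (C : List (Gate W)) :
    opOfGates C = basisOp (run C) := by
  induction C with
  | nil => exact basisOp_id.symm
  | cons g C ih => rw [opOfGates, ih, Gate.op, basisOp_mul]; rfl

theorem tensor_basisOp {A B : Type} [Fintype A] [Fintype B] (f : (A → Bool) → (A → Bool))
    (g : (B → Bool) → (B → Bool)) :
    tensor (basisOp f) (basisOp g) = basisOp fun x =>
      Sum.elim (f fun a => x (Sum.inl a)) (g fun b => x (Sum.inr b)) := by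
  ext y x
  have : y = Sum.elim (f fun a => x (Sum.inl a)) (g fun b => x (Sum.inr b)) ↔
      (fun a => y (Sum.inl a)) = (f fun a => x (Sum.inl a)) ∧
      (fun b => y (Sum.inr b)) = (g fun b => x (Sum.inr b)) := by
    constructor
    · rintro rfl
      exact ⟨rfl, rfl⟩
    · rintro ⟨h1, h2⟩
      funext w
      rcases w with a | b
      · exact congrFun h1 a
      · exact congrFun h2 b
  simp only [tensor, basisOp, Matrix.submatrix_apply, Matrix.kroneckerMap_apply, Matrix.of_apply,
    this]
  change (if (fun a => y (Sum.inl a)) = (f fun a => x (Sum.inl a)) then (1 : ℂ) else 0) *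
    (if (fun b => y (Sum.inr b)) = (g fun b => x (Sum.inr b)) then (1 : ℂ) else 0) = _
  by_cases h1 : (fun a => y (Sum.inl a)) = (f fun a => x (Sum.inl a)) <;> simp [h1]

theorem controlled_basisOp (k : ℕ) {W : Type} [Fintype W] [DecidableEq W]
    (f : (W → Bool) → (W → Bool)) :
    controlled k (basisOp f) = basisOp fun x =>
      if ∀ i, x (Sum.inl i) = true then
        Sum.elim (fun a => x (Sum.inl a)) (f fun b => x (Sum.inr b)) else x := by
  ext y x
  have e1 : tensor (1 : Op (Fin k)) (basisOp f) = basisOp fun x =>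
      Sum.elim (fun a => x (Sum.inl a)) (f fun b => x (Sum.inr b)) := by
    rw [← basisOp_id, tensor_basisOp]; rfl
  have e2 : tensor (1 : Op (Fin k)) (1 : Op W) = basisOp id := by
    rw [← basisOp_id, ← basisOp_id, tensor_basisOp]
    congr 1
    funext x w
    rcases w with a | b <;> rfl
  have key : controlled k (basisOp f) y x =
      if ∀ i, x (Sum.inl i) = true then tensor (1 : Op (Fin k)) (basisOp f) y x
      else tensor (1 : Op (Fin k)) 1 y x := by
    simp only [controlled, tensor, Matrix.add_apply, Matrix.submatrix_apply,
      Matrix.kroneckerMap_apply, Matrix.sub_apply, Matrix.single_apply]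
    have hx : (fun _ => true) = (Equiv.sumArrowEquivProdArrow (Fin k) W Bool x).1 ↔
        ∀ i, x (Sum.inl i) = true := by
      rw [funext_iff]
      exact forall_congr' fun i => eq_comm
    by_cases h : ∀ i, x (Sum.inl i) = true
    · simp only [hx, h, implies_true, and_true, if_true, Matrix.one_apply]
      rw [← hx.2 h]
      simp only [eq_comm (a := fun _ => true)]
      ring
    · simp [hx, h]
  rw [key, e1, e2]
  by_cases h : ∀ i, x (Sum.inl i) = true
  · simp [h, basisOp]
  · simp [h, basisOp]

end Matrices

/-! ### The controlled comparator as a nested expression -/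

section Target

/-- The qubits of the controlled comparator with an ancilla. -/
abbrev Qubits (k n : ℕ) : Type := (Fin k ⊕ (Fin n ⊕ Fin 1)) ⊕ Fin 1

/-- The target qubit of the comparator. -/
abbrev targetQubit (k n : ℕ) : Qubits k n := Sum.inl (Sum.inr (Sum.inr 0))

/-- The bit that the controlled comparator adds to the target. -/
def outcome {k n : ℕ} (c : Fin n → Bool) (x : Qubits k n → Bool) : Bool :=
  decide (∀ i, x (Sum.inl (Sum.inl i)) = true) &&
    decide (value c < value fun i => x (Sum.inl (Sum.inr (Sum.inl i))))

theorem tensor_controlled_comparator {k n : ℕ} (c : Fin n → Bool) :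
    tensor (controlled k (comparator c)) (1 : Op (Fin 1)) = basisOp fun x =>
      Function.update x (targetQubit k n) (xor (x (targetQubit k n)) (outcome c x)) := by
  rw [comparator, controlled_basisOp, ← basisOp_id, tensor_basisOp]
  congr 1
  funext x w
  rcases w with (i | i | i) | i
  · by_cases h : ∀ i, x (Sum.inl (Sum.inl i)) = true <;> simp [h]
  · by_cases h : ∀ i, x (Sum.inl (Sum.inl i)) = true <;> simp [h]
  · obtain rfl : i = 0 := Subsingleton.elim _ _
    by_cases h : ∀ i, x (Sum.inl (Sum.inl i)) = true <;> simp [h, outcome]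
  · simp

theorem implements_iff {k n : ℕ} (c : Fin n → Bool) (C : Circuit (Qubits k n)) :
    C.ImplementsWithDirtyAncilla (controlled k (comparator c)) ↔
      Toggles C.gates (targetQubit k n) (outcome c) := by
  rw [Circuit.ImplementsWithDirtyAncilla, Circuit.op, opOfGates_eq, tensor_controlled_comparator]
  exact ⟨fun h x => congrFun (basisOp_injective h) x, fun h => congrArg _ (funext h)⟩

theorem value_succ {n : ℕ} (x : Fin (n + 1) → Bool) :
    value x = value (fun i : Fin n => x i.castSucc) + if x (Fin.last n) then 2 ^ n else 0 := by
  simp [value, Fin.sum_univ_castSucc]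

theorem value_lt {n : ℕ} (x : Fin n → Bool) : value x < 2 ^ n := by
  induction n with
  | zero => simp [value]
  | succ n ih =>
    have := ih fun i => x i.castSucc
    rw [value_succ, pow_succ]
    split <;> omega

/-- The entry after the last bit that is read before a bit `0` occurs. -/
def firstZero {W : Type} (l : List (W × Bool)) (x : W → Bool) : Bool :=
  l.foldr (fun p r => if x p.1 then r else p.2) false

/-- Reading from the most significant bit, the first disagreement decides, and there c < a exactly
when the bit of `c` is 0. Without disagreement the default `false` is right. -/
theorem firstZero_compare {n : ℕ} (c a : Fin n → Bool) :
    firstZero ((List.finRange n).reverse.map fun i => (i, !c i)) (fun i => a i == c i) =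
      decide (value c < value a) := by
  induction n with
  | zero => simp [firstZero, value]
  | succ n ih =>
    have h1 := value_lt fun i : Fin n => c i.castSucc
    have h2 := value_lt fun i : Fin n => a i.castSucc
    have h3 := ih (fun i => c i.castSucc) (fun i => a i.castSucc)
    simp only [firstZero, List.foldr_map] at h3 ⊢
    rw [List.finRange_succ_last, List.reverse_append, List.reverse_singleton, List.singleton_append,
      List.foldr_cons, ← List.map_reverse, List.foldr_map, h3, value_succ c, value_succ a]
    cases hc : c (Fin.last n) <;> cases ha : a (Fin.last n) <;> simp <;> omega

theorem firstZero_controls {W : Type} (L : List W) (l : List (W × Bool)) (x : W → Bool) :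
    firstZero (L.map (fun w => (w, false)) ++ l) x =
      (decide (∀ w ∈ L, x w = true) && firstZero l x) := by
  induction L with
  | nil => simp
  | cons w L ih =>
    have : firstZero ((w :: L).map (fun w => (w, false)) ++ l) x =
      if x w then firstZero (L.map (fun w => (w, false)) ++ l) x else false := rfl
    rw [this, ih]
    by_cases h : x w = true <;> simp [h]

/-- The entry of the first pair. -/
def headFlag {W : Type} (l : List (W × Bool)) : Bool := l.head?.elim false Prod.snd

/-- The differences of consecutive entries. -/
def flagDiff {W : Type} : List (W × Bool) → List (W × Bool)
  | [] => []
  | p :: l => (p.1, xor p.2 (headFlag l)) :: flagDiff l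

theorem map_fst_flagDiff {W : Type} (l : List (W × Bool)) :
    (flagDiff l).map Prod.fst = l.map Prod.fst := by
  induction l with
  | nil => rfl
  | cons p l ih => simp [flagDiff, ih]

/-- Telescoping: each further bit 1 replaces the current flag by the next one, that is, adds their
difference. -/
theorem val_flagDiff {W : Type} [Fintype W] [DecidableEq W] (l : List (W × Bool)) (x : W → Bool) :
    val false (flagDiff l) x = xor (headFlag l) (firstZero l x) := by
  induction l with
  | nil => rfl
  | cons p l ih =>
    have h1 : firstZero (p :: l) x = if x p.1 then firstZero l x else p.2 := rfl
    have h2 : headFlag (p :: l) = p.2 := rfl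
    rw [flagDiff, val_cons, ih, h1, h2]
    cases x p.1 <;> cases p.2 <;> cases headFlag l <;> cases firstZero l x <;> rfl

/-- The controls and the bits of the number to be compared, from the most significant one on. -/
def dataList (k : ℕ) {n : ℕ} (c : Fin n → Bool) : List (Qubits k n × Bool) :=
  ((List.finRange k).map fun i => Sum.inl (Sum.inl i)).map (fun w => (w, false)) ++
    (List.finRange n).reverse.map fun i => (Sum.inl (Sum.inr (Sum.inl i)), !c i)

theorem length_dataList (k : ℕ) {n : ℕ} (c : Fin n → Bool) : (dataList k c).length = k + n := by
  simp [dataList]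

/-- The bits where the constant is `0`. -/
def zeroBits (k : ℕ) {n : ℕ} (c : Fin n → Bool) : List (Qubits k n) :=
  ((List.finRange n).filter fun i => !c i).map fun i => Sum.inl (Sum.inr (Sum.inl i))

theorem nodup_zeroBits (k : ℕ) {n : ℕ} (c : Fin n → Bool) : (zeroBits k c).Nodup :=
  ((List.nodup_finRange n).filter _).map fun i j h => by simpa using h

theorem outcome_eq {k n : ℕ} (hk : 1 ≤ k) (c : Fin n → Bool) (x : Qubits k n → Bool) :
    val false (flagDiff (dataList k c)) (run ((zeroBits k c).map Gate.notGate) x) =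
      outcome c x := by
  set y := run ((zeroBits k c).map Gate.notGate) x with hy
  have h1 : ∀ i, y (Sum.inl (Sum.inl i)) = x (Sum.inl (Sum.inl i)) := fun i => by
    rw [hy, run_map_notGate _ (nodup_zeroBits k c), if_neg (by simp [zeroBits])]
  have h2 : ∀ i, y (Sum.inl (Sum.inr (Sum.inl i))) =
      (x (Sum.inl (Sum.inr (Sum.inl i))) == c i) := fun i => by
    rw [hy, run_map_notGate _ (nodup_zeroBits k c)]
    cases hc : c i <;> simp [zeroBits, hc]
  -- The list begins with a control, whose flag is `false`, so no constant is left over from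
  -- telescoping.
  have h3 : headFlag (dataList k c) = false := by
    obtain ⟨k, rfl⟩ : ∃ m, k = m + 1 := ⟨k - 1, by omega⟩
    simp [dataList, headFlag, List.finRange_succ]
  rw [val_flagDiff, h3, Bool.false_xor, dataList, firstZero_controls, outcome,
    ← firstZero_compare]
  congr 1
  · simp [h1]
  · simp only [firstZero, List.foldr_map, h2]

theorem exists_toggle_outcome {k n : ℕ} (hk : 1 ≤ k) (c : Fin n → Bool) :
    ∃ C : List (Gate (Qubits k n)), Toggles C (targetQubit k n) (outcome c) ∧
    C.length ≤ 2 ^ 40 * (k + n) + 2 * n ∧ Sched C (2 ^ 40 * (Nat.log 2 (k + n) + 1) + 2) := by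
  have hlen : (flagDiff (dataList k c)).length = k + n := by
    rw [← length_dataList k c, ← List.length_map (f := Prod.fst), map_fst_flagDiff,
      List.length_map]
  obtain ⟨C, h1, h2, h3⟩ := exists_toggle_val (flagDiff (dataList k c)) (targetQubit k n)
    (Sum.inr 0) (by
      rw [map_fst_flagDiff, dataList]
      simp only [List.map_append, List.map_map, Function.comp_def]
      rw [List.nodup_append, List.nodup_append]
      refine ⟨⟨(List.nodup_finRange k).map fun i j h => by simpa using h,
        (List.nodup_reverse.2 (List.nodup_finRange n)).map fun i j h => by simpa using h,
        by simp⟩, by simp, by simp⟩) (by omega)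
  rw [hlen] at h2 h3
  have hz : (zeroBits k c).length ≤ n := by
    rw [zeroBits, List.length_map]
    exact (List.length_filter_le _ _).trans (by simp)
  have hs := sched_map_notGate _ (nodup_zeroBits k c)
  refine ⟨(zeroBits k c).map Gate.notGate ++ (C ++ ((zeroBits k c).map Gate.notGate).reverse),
    fun x => ?_, ?_, (hs.append (h3.append hs.reverse)).mono (by omega)⟩
  · have hw := within_map_notGate (zeroBits k c)
    have ht : targetQubit k n ∉ zeroBits k c := by simp [zeroBits]
    rw [run_append, run_append, h1 _, hw.reverse.run_update ht, run_reverse_run, outcome_eq hk,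
      hw.run_of_notMem x ht]
  · simp only [List.length_append, List.length_reverse, List.length_map]
    omega

end Target

/-! ### Nonempty layers, padding, and light cones -/

section Layers

set_option linter.unusedSectionVars false

variable {W : Type} [Fintype W] [DecidableEq W]

theorem exists_layers (ls : List (List (Gate W)))
    (h : ∀ l ∈ ls, l.Pairwise fun g h => Disjoint g.support h.support) :
    ∃ Ls : List (Layer W), Ls.length ≤ ls.length ∧ Ls.flatMap Layer.gates = ls.flatten := by
  induction ls with
  | nil => exact ⟨[], by simp, by simp⟩
  | cons l ls ih =>
    obtain ⟨Ls, h1, h2⟩ := ih fun l' hl' => h l' (List.mem_cons_of_mem _ hl')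
    by_cases hl : l = []
    · exact ⟨Ls, by simp; omega, by simp [h2, hl]⟩
    · exact ⟨⟨l, hl, h l List.mem_cons_self⟩ :: Ls, by simpa using h1, by simp [h2]⟩

theorem Sched.exists_circuit {C : List (Gate W)} {d : ℕ} (h : Sched C d) :
    ∃ Q : Circuit W, Q.depth ≤ d ∧ Q.size = C.length ∧ ∀ x, run Q.gates x = run C x := by
  obtain ⟨ls, h1, h2, h3, h4⟩ := h
  obtain ⟨Ls, k1, k2⟩ := exists_layers ls h2
  refine ⟨⟨Ls⟩, k1.trans h1, ?_, fun x => ?_⟩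
  · rw [Circuit.size, Circuit.gates, k2, h3.length_eq]
  · rw [Circuit.gates, k2, h4]

theorem run_map_notGate_twice (L : List W) (hL : L.Nodup) (x : W → Bool) :
    run (L.map Gate.notGate) (run (L.map Gate.notGate) x) = x := by
  funext w
  rw [run_map_notGate L hL, run_map_notGate L hL]
  split <;> simp

/-- Padding that forces the lower bounds on size and depth for constants whose comparator is cheap,
such as c = 2 ^ n - 1, where it is the identity. Two full layers of NOT gates give linear size;
pairs of single NOT gates give the depth. -/
theorem exists_identity_layers [Nonempty W] (m : ℕ) : ∃ Ls : List (Layer W),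
    Ls.length = 2 * m + 2 ∧ (Ls.flatMap Layer.gates).length = 2 * m + 2 * Fintype.card W ∧
    ∀ x, run (Ls.flatMap Layer.gates) x = x := by
  have hpw : ∀ L : List W, L.Nodup → (L.map Gate.notGate).Pairwise
      fun g h => Disjoint g.support h.support := fun L hL =>
    List.pairwise_map.2 (hL.imp fun h => by simpa using h)
  induction m with
  | zero =>
    have hn := Finset.nodup_toList (Finset.univ : Finset W)
    let A : Layer W := ⟨(Finset.univ : Finset W).toList.map Gate.notGate,
      by simp [Finset.univ_nonempty.ne_empty], hpw _ hn⟩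
    refine ⟨[A, A], by simp, by simp [A]; omega, fun x => ?_⟩
    simp [A, run_map_notGate_twice _ hn]
  | succ m ih =>
    obtain ⟨Ls, h1, h2, h3⟩ := ih
    let w : W := Classical.arbitrary W
    let A : Layer W := ⟨[w].map Gate.notGate, by simp, hpw _ (by simp)⟩
    refine ⟨A :: A :: Ls, by simp [h1]; omega, by simp [A, h2]; omega, fun x => ?_⟩
    rw [List.flatMap_cons, List.flatMap_cons, run_append, run_append, h3]
    exact run_map_notGate_twice [w] (by simp) x

theorem Gate.card_support_le (g : Gate W) : g.support.card ≤ 3 :=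
  (Finset.card_insert_le _ _).trans (by have := g.card_le; omega)

/-- The bits of a layer that determine the bit `w` afterwards. -/
theorem exists_cone_of_layer (C : List (Gate W))
    (hC : C.Pairwise fun g h => Disjoint g.support h.support) (w : W) :
    ∃ S : Finset W, S.card ≤ 3 ∧ (∀ v ∈ S, v = w ∨ ∃ g ∈ C, v ∈ g.support) ∧
    ∀ x y : W → Bool, (∀ v ∈ S, x v = y v) → run C x w = run C y w := by
  induction C with
  | nil => exact ⟨{w}, by simp, by simp, by simp⟩
  | cons g C ih =>
    obtain ⟨hg, hC⟩ := List.pairwise_cons.1 hC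
    by_cases hw : w ∈ g.support
    · have hwC : ∀ x, run C x w = x w := fun x =>
        Within.run_of_notMem (L := ({w}ᶜ : Finset W).toList) (fun g' hg' v hv => by
          simp only [Finset.mem_toList, Finset.mem_compl, Finset.mem_singleton]
          rintro rfl
          exact Finset.disjoint_left.1 (hg g' hg') hw hv) x (by simp)
      refine ⟨g.support, g.card_support_le, fun v hv => .inr ⟨g, by simp, hv⟩, fun x y h => ?_⟩
      rw [run_cons, run_cons, hwC, hwC]
      exact g.act_congr (h w hw) h
    · obtain ⟨S, h1, h2, h3⟩ := ih hC
      refine ⟨S, h1, fun v hv => ?_, fun x y h => h3 _ _ fun v hv => ?_⟩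
      · rcases h2 v hv with h | ⟨g', hg', hv'⟩
        · exact .inl h
        · exact .inr ⟨g', List.mem_cons_of_mem _ hg', hv'⟩
      -- The second property of `S` is used here: `g` meets neither `w` nor the other gates of the
      -- layer, so it leaves `S` unchanged.
      · have hv' : v ∉ g.support := by
          rcases h2 v hv with rfl | ⟨g', hg', hv'⟩
          · exact hw
          · exact fun h => Finset.disjoint_left.1 (hg g' hg') h hv'
        exact (g.act_of_ne x hv').trans ((h v hv).trans (g.act_of_ne y hv').symm)

/-- The bits that determine the bits `T` after the layers. -/
theorem exists_cone (Ls : List (Layer W)) (T : Finset W) :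
    ∃ S : Finset W, S.card ≤ 3 ^ Ls.length * T.card ∧
    ∀ x y : W → Bool, (∀ v ∈ S, x v = y v) →
      ∀ w ∈ T, run (Ls.flatMap Layer.gates) x w = run (Ls.flatMap Layer.gates) y w := by
  induction Ls with
  | nil => exact ⟨T, by simp, by simp⟩
  | cons A Ls ih =>
    obtain ⟨S, h1, h2⟩ := ih
    choose f f1 _ f3 using exists_cone_of_layer A.gates A.disjoint
    refine ⟨S.biUnion f, ?_, fun x y h w hw => ?_⟩
    · refine (Finset.card_biUnion_le_card_mul S f 3 fun w _ => f1 w).trans ?_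
      rw [List.length_cons, pow_succ]
      calc S.card * 3 ≤ (3 ^ Ls.length * T.card) * 3 := Nat.mul_le_mul_right 3 h1
        _ = 3 ^ Ls.length * 3 * T.card := by ring
    · rw [List.flatMap_cons, run_append, run_append]
      exact h2 _ _ (fun v hv => f3 v x y fun u hu => h u (Finset.mem_biUnion.2 ⟨v, hv, hu⟩)) w hw

/-- The bits that are touched by the gates, and the bit `w` itself, determine `w`. -/
theorem exists_touched (C : List (Gate W)) (w : W) :
    ∃ S : Finset W, S.card ≤ 3 * C.length + 1 ∧
    ∀ x y : W → Bool, (∀ v ∈ S, x v = y v) → run C x w = run C y w := by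
  have hU : ∃ U : Finset W, U.card ≤ 3 * C.length ∧ Within C U.toList := by
    induction C with
    | nil => exact ⟨∅, by simp, Within.nil _⟩
    | cons g C ih =>
      obtain ⟨U, h1, h2⟩ := ih
      refine ⟨g.support ∪ U, (Finset.card_union_le _ _).trans ?_,
        Within.cons (by simp +contextual) (h2.mono (by simp +contextual))⟩
      have := g.card_support_le
      rw [List.length_cons]
      omega
  obtain ⟨U, h1, h2⟩ := hU
  refine ⟨insert w U, (Finset.card_insert_le _ _).trans (by omega), fun x y h => ?_⟩
  exact h2.run_congr (fun v hv => h v (by simp at hv; simp [hv])) (h w (by simp))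

end Layers

/-! ### Sensitivity of the comparator with constant 0 -/

section LowerBound

/-- With the constant `0`, the target depends on all other bits. -/
theorem le_card_of_toggles {k n : ℕ} (hn : 1 ≤ n) {C : List (Gate (Qubits k n))}
    (hC : Toggles C (targetQubit k n) (outcome fun _ : Fin n => false))
    (S : Finset (Qubits k n)) (hS : ∀ x y : Qubits k n → Bool, (∀ v ∈ S, x v = y v) →
      run C x (targetQubit k n) = run C y (targetQubit k n)) : k + n ≤ S.card := by
  have hpos : ∀ a : Fin n → Bool, value (fun _ : Fin n => false) < value a ↔ ∃ i, a i = true := by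
    intro a
    have h0 : value (fun _ : Fin n => false) = 0 := by simp [value]
    rw [h0, Nat.pos_iff_ne_zero, ← not_iff_not]
    simp [value, Finset.sum_eq_zero_iff]
  have key : ∀ (x : Qubits k n → Bool) (q : Qubits k n), q ≠ targetQubit k n →
      outcome (fun _ : Fin n => false) x ≠
        outcome (fun _ : Fin n => false) (Function.update x q (!x q)) → q ∈ S := by
    intro x q hq hne
    by_contra hqS
    apply hne
    have := hS x (Function.update x q (!x q)) fun v hv => by
      rw [Function.update_of_ne fun e => hqS (by rwa [← e])]
    rw [hC x, hC, Function.update_self, Function.update_self, Function.update_of_ne hq.symm] at this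
    simpa using this
  have h1 : ∀ i : Fin k, (Sum.inl (Sum.inl i) : Qubits k n) ∈ S := fun i => by
    -- With all bits 1, switching off any single control changes the outcome.
    refine key (fun _ => true) _ (by simp) ?_
    simp only [outcome, hpos, Bool.not_true]
    have e : ¬ ∀ j : Fin k, Function.update (fun _ : Qubits k n => true)
        (Sum.inl (Sum.inl i)) false (Sum.inl (Sum.inl j)) = true := fun h => by
      simpa using h i
    have e' : ∃ _ : Fin n, True := ⟨⟨0, hn⟩, trivial⟩
    rw [decide_eq_false e]
    simpa using e'
  have h2 : ∀ i : Fin n, (Sum.inl (Sum.inr (Sum.inl i)) : Qubits k n) ∈ S := fun i => by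
    -- With all controls on and a = 0, switching on any single bit of a changes the outcome.
    refine key (Sum.elim (Sum.elim (fun _ => true) fun _ => false) fun _ => false) _ (by simp) ?_
    simp only [outcome, hpos]
    have e : ∃ j : Fin n, Function.update (Sum.elim (Sum.elim (fun _ => true) fun _ => false)
        fun _ => false : Qubits k n → Bool) (Sum.inl (Sum.inr (Sum.inl i))) (!false)
        (Sum.inl (Sum.inr (Sum.inl j))) = true := ⟨i, by simp⟩
    simp at e
    simp [e]
  have hinj : Function.Injective (Sum.elim (fun i : Fin k => (Sum.inl (Sum.inl i) : Qubits k n))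
      fun i : Fin n => Sum.inl (Sum.inr (Sum.inl i))) := by
    rintro (i | i) (j | j) h <;> simp at h <;> rw [h]
  have hle := Finset.card_le_card_of_injOn (s := Finset.univ) (t := S) _
    (fun q _ => by rcases q with i | i; exacts [h1 i, h2 i]) hinj.injOn
  simpa using hle

end LowerBound

/-! ### Comparison of logarithms and conclusion -/

theorem log_mul_bounds {k n : ℕ} (hk : 1 ≤ k) (hn : 1 ≤ n) (hkn : 2 ≤ k * n) :
    ((Nat.log 2 (k + n) + 1 : ℕ) : ℝ) ≤ 6 * Real.log ((k : ℝ) * n) ∧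
    Real.log ((k : ℝ) * n) ≤ 2 * Real.log ((k + n : ℕ) : ℝ) ∧
    Real.log ((k + n : ℕ) : ℝ) ≤ (Nat.log 2 (k + n) + 1 : ℕ) := by
  have hk' : (1 : ℝ) ≤ k := by exact_mod_cast hk
  have hn' : (1 : ℝ) ≤ n := by exact_mod_cast hn
  have hkn' : (2 : ℝ) ≤ (k : ℝ) * n := by exact_mod_cast hkn
  have h2 : (1 : ℝ) / 2 < Real.log 2 := by have := Real.log_two_gt_d9; linarith
  have h2' : Real.log 2 < 1 := by have := Real.log_two_lt_d9; linarith
  have hN : (0 : ℝ) < ((k + n : ℕ) : ℝ) := by push_cast; linarith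
  have hlog2 : Real.log 2 ≤ Real.log ((k : ℝ) * n) := Real.log_le_log (by norm_num) hkn'
  -- From (k - 1)(n - 1) ≥ 0 one gets k + n ≤ kn + 1, which is at most (kn)² because kn ≥ 2.
  have hsum : ((k + n : ℕ) : ℝ) ≤ ((k : ℝ) * n) ^ 2 := by
    push_cast
    nlinarith [mul_nonneg (sub_nonneg.2 hk') (sub_nonneg.2 hn')]
  have hprod : (k : ℝ) * n ≤ ((k + n : ℕ) : ℝ) ^ 2 := by
    push_cast
    nlinarith
  have h1 : Real.log ((k + n : ℕ) : ℝ) ≤ 2 * Real.log ((k : ℝ) * n) := by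
    have := Real.log_le_log hN hsum
    rwa [Real.log_pow] at this
  refine ⟨?_, ?_, ?_⟩
  · have hp : ((2 ^ Nat.log 2 (k + n) : ℕ) : ℝ) ≤ ((k + n : ℕ) : ℝ) :=
      Nat.cast_le.2 (Nat.pow_log_le_self 2 (by omega))
    have := Real.log_le_log (by positivity) hp
    rw [Nat.cast_pow, Real.log_pow, Nat.cast_ofNat] at this
    push_cast
    nlinarith [(Nat.cast_nonneg (Nat.log 2 (k + n)) : (0 : ℝ) ≤ _)]
  · have := Real.log_le_log (by linarith) hprod
    rwa [Real.log_pow] at this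
  · have hp : ((k + n : ℕ) : ℝ) ≤ ((2 ^ (Nat.log 2 (k + n) + 1) : ℕ) : ℝ) :=
      Nat.cast_le.2 (Nat.lt_pow_succ_log_self (by norm_num) _).le
    have := Real.log_le_log hN hp
    rw [Nat.cast_pow, Real.log_pow, Nat.cast_ofNat] at this
    have h0 : (0 : ℝ) ≤ ((Nat.log 2 (k + n) + 1 : ℕ) : ℝ) := Nat.cast_nonneg _
    nlinarith

theorem exists_circuit {k n : ℕ} (hk : 1 ≤ k) (hn : 1 ≤ n) (c : Fin n → Bool) :
    ∃ C : Circuit (Qubits k n), C.ImplementsWithDirtyAncilla (controlled k (comparator c)) ∧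
    k + n ≤ C.size ∧ C.size ≤ 2 ^ 41 * (k + n) ∧ Nat.log 2 (k + n) + 1 ≤ C.depth ∧
    C.depth ≤ 2 ^ 41 * (Nat.log 2 (k + n) + 1) := by
  obtain ⟨C, h1, h2, h3⟩ := exists_toggle_outcome hk c
  obtain ⟨Q, q1, q2, q3⟩ := h3.exists_circuit
  obtain ⟨Ls, l1, l2, l3⟩ := exists_identity_layers (W := Qubits k n) (Nat.log 2 (k + n))
  have hcard : Fintype.card (Qubits k n) = k + n + 2 := by simp; omega
  have hlog : Nat.log 2 (k + n) ≤ k + n := Nat.log_le_self _ _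
  have hg : (⟨Q.layers ++ Ls⟩ : Circuit (Qubits k n)).gates =
      Q.gates ++ Ls.flatMap Layer.gates := by
    simp [Circuit.gates]
  have hs : (⟨Q.layers ++ Ls⟩ : Circuit (Qubits k n)).size =
      Q.size + (Ls.flatMap Layer.gates).length := by
    rw [Circuit.size, hg, List.length_append, Circuit.size]
  have hd : (⟨Q.layers ++ Ls⟩ : Circuit (Qubits k n)).depth = Q.depth + Ls.length := by
    simp [Circuit.depth]
  refine ⟨⟨Q.layers ++ Ls⟩, (implements_iff c _).2 fun x => ?_, ?_, ?_, ?_, ?_⟩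
  · rw [hg, run_append, l3, q3, h1 x]
  · omega
  · omega
  · omega
  · omega

theorem lower_bound {k n : ℕ} (hk : 1 ≤ k) (hn : 1 ≤ n) {C : Circuit (Qubits k n)}
    (hC : C.ImplementsWithDirtyAncilla (controlled k (comparator fun _ : Fin n => false))) :
    k + n ≤ 4 * C.size ∧ k + n ≤ 3 ^ C.depth := by
  rw [implements_iff] at hC
  obtain ⟨S, s1, s2⟩ := exists_touched C.gates (targetQubit k n)
  obtain ⟨T, t1, t2⟩ := exists_cone C.layers {targetQubit k n}
  have h1 := le_card_of_toggles hn hC S s2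
  have h2 := le_card_of_toggles hn hC T fun x y h => t2 x y h _ (by simp)
  rw [Finset.card_singleton, mul_one] at t1
  refine ⟨?_, h2.trans t1⟩
  rw [Circuit.size]
  -- The count of touched bits gives k + n ≤ 3 · size + 1; as k + n ≥ 2, the size is positive and
  -- absorbs the 1.
  omega

end QCircuit

theorem mainTheorem11 :
    ∃ α β : ℝ, 0 < α ∧ 0 < β ∧ ∀ k n : ℕ, 1 ≤ k → 1 ≤ n → 2 ≤ k * n →
      (∀ c : Fin n → Bool, ∃ C : QCircuit.Circuit ((Fin k ⊕ (Fin n ⊕ Fin 1)) ⊕ Fin 1),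
        C.ImplementsWithDirtyAncilla (QCircuit.controlled k (QCircuit.comparator c)) ∧
        α * ((k : ℝ) + n) ≤ C.size ∧ (C.size : ℝ) ≤ β * ((k : ℝ) + n) ∧
        α * Real.log ((k : ℝ) * n) ≤ C.depth ∧ (C.depth : ℝ) ≤ β * Real.log ((k : ℝ) * n)) ∧
      (∃ c : Fin n → Bool, ∀ C : QCircuit.Circuit ((Fin k ⊕ (Fin n ⊕ Fin 1)) ⊕ Fin 1),
        C.ImplementsWithDirtyAncilla (QCircuit.controlled k (QCircuit.comparator c)) →
        α * ((k : ℝ) + n) ≤ C.size ∧ α * Real.log ((k : ℝ) * n) ≤ C.depth) := by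
  -- The depth bound needs log(kn) ≤ 2 log(k + n) ≤ 2 · log 3 · depth ≤ 4 · depth, hence 1/4; and 2
  -- ^ 41 · 6 ≤ 2 ^ 44.
  refine ⟨1 / 4, 2 ^ 44, by norm_num, by norm_num, fun k n hk hn hkn => ?_⟩
  obtain ⟨h1, h2, h3⟩ := QCircuit.log_mul_bounds hk hn hkn
  have hpos : (0 : ℝ) ≤ (k : ℝ) + n := by positivity
  refine ⟨fun c => ?_, fun _ => false, fun C hC => ?_⟩
  · obtain ⟨C, c1, c2, c3, c4, c5⟩ := QCircuit.exists_circuit hk hn c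
    have c2' : ((k : ℝ) + n) ≤ C.size := by exact_mod_cast c2
    have c3' : (C.size : ℝ) ≤ 2 ^ 41 * ((k : ℝ) + n) := by exact_mod_cast c3
    have c4' : ((Nat.log 2 (k + n) + 1 : ℕ) : ℝ) ≤ C.depth := by exact_mod_cast c4
    have c5' : (C.depth : ℝ) ≤ 2 ^ 41 * ((Nat.log 2 (k + n) + 1 : ℕ) : ℝ) := by exact_mod_cast c5
    have h0 : (0 : ℝ) ≤ ((Nat.log 2 (k + n) + 1 : ℕ) : ℝ) := Nat.cast_nonneg _
    exact ⟨C, c1, by linarith, by linarith, by linarith, by linarith⟩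
  · obtain ⟨c1, c2⟩ := QCircuit.lower_bound hk hn hC
    have c1' : ((k : ℝ) + n) ≤ 4 * C.size := by exact_mod_cast c1
    have c2' : ((k + n : ℕ) : ℝ) ≤ (3 : ℝ) ^ C.depth := by exact_mod_cast c2
    have hl := Real.log_le_log (by push_cast; linarith [(Nat.one_le_cast.2 hk : (1 : ℝ) ≤ k),
      (Nat.cast_nonneg n : (0 : ℝ) ≤ n)]) c2'
    rw [Real.log_pow] at hl
    have h30 : Real.log 3 ≤ 2 := by
      have := Real.log_le_sub_one_of_pos (show (0 : ℝ) < 3 by norm_num); linarith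
    have hd : (0 : ℝ) ≤ C.depth := Nat.cast_nonneg _
    exact ⟨by linarith, by nlinarith⟩
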